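/- Let $H(t,q,p):\mathbb R\times\mathbb R^d\times\mathbb R^{d*}\to\mathbb R$ be a $C^2$ Hamiltonian and let $m>0$ and $M$ be constants such that, for all $(t,q,p)$, $$\|d^2H(t,q,p)\|\le M,\qquad \partial^2_{pp}H(t,q,p)\ge m\,\mathrm{Id},\qquad \tfrac m2|p|^2-M\le H(t,q,p)\le \tfrac M2|p|^2+M .$$ Let $\varphi_\tau^t=(Q_\tau^t,P_\tau^t)$ be the (complete) flow, from time $\tau$ to time $t$, of the Hamiltonian system $\dot q=\partial_pH(t,q,p)$, $\dot p=-\partial_qH(t,q,p)$. Let $\sigma=m^2/(64M^3)$; for $0<t-\tau<\sigma$ any two points $q_0,q_1\in\mathbb R^d$ are joined by exactly one orbit $(q(s),p(s))$ with $q(\tau)=q_0$, $q(t)=q_1$, and $S_\tau^t(q_0,q_1)=\int_\tau^t p\cdot\dot q-H(s,q,p)\,ds$ denotes its action. For all $\tau<t$ let $$A_\tau^t(q_0,q_1)=\min_{\theta_1,\dots,\theta_{n-1}}\ \sum_{i=0}^{n-1}S_{\tau+i(t-\tau)/n}^{\tau+(i+1)(t-\tau)/n}(\theta_i,\theta_{i+1}),\qquad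 \theta_0=q_0,\ \theta_n=q_1,$$ where $n\ge1$ is any integer with $(t-\tau)/n<\sigma$ (so $A_\tau^t=S_\tau^t$ if $t-\tau<\sigma$). For $u:\mathbb R^d\to\mathbb R$ let $$\mathbf T_\tau^tu(q)=\inf_\theta\big(u(\theta)+A_\tau^t(\theta,q)\big),\qquad \check{\mathbf T}_t^\tau u(q)=\sup_\theta\big(u(\theta)-A_\tau^t(q,\theta)\big).$$ Call $u$ $K$-semi-convex if $u+K|\cdot|^2$ is convex, and $C^{1,1}$ if it is differentiable with Lipschitz differential. Let $\Gamma_u=\{(q,du(q)) : du(q)\text{ exists}\}$, and let $L_u$ be the set of pairs $(Q,P)$ such that $P$ is a sub-differential of $u$ at $Q$ (there is a $C^1$ function $v$ with $dv(Q)=P$ such that $u-v$ has a minimum at $Q$). Let $K\ge0$, let $u:\mathbb R^d\to\mathbb R$ be $K$-semi-convex, let $\delta\in\,]0,1[$ and let $$T=\frac{\delta}{2M(3+2K)^2}.$$ Then for each $t\in\,]0,T]$: 1. the function $\mathbf T_0^tu$ is finite at each point, $(K+\delta)$-semi-convex, and $C^{1,1}$; 2. $L_u=\varphi_t^0\big(\Gamma_{\mathbf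 T_0^tu}\big)$, and for each $q\in\mathbb R^d$ we have $\mathbf T_0^tu(q)=u(\theta)+A_0^t(\theta,q)$ with $\theta=Q_t^0\big(q,d(\mathbf T_0^tu)(q)\big)$; 3. $\check{\mathbf T}_t^0\big(\mathbf T_0^tu\big)$ is finite at each point, and $\check{\mathbf T}_t^0\circ\mathbf T_0^tu=u$. -/

import Mathlib

open scoped InnerProductSpace

noncomputable section

namespace WeakKAM

/-- The space `ℝᵈ` with its Euclidean structure. The dual space `ℝᵈ*` of momenta is identified with
`ℝᵈ` through the inner product, so a differential `du(q)` is represented by the gradient of `u`. -/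
abbrev Space (d : ℕ) : Type := EuclideanSpace ℝ (Fin d)

/-- The Euclidean norm on `ℝ × ℝᵈ × ℝᵈ*` (Mathlib's norm on products is the sup norm). -/
def euclNorm {d : ℕ} (v : ℝ × Space d × Space d) : ℝ :=
  Real.sqrt (v.1 ^ 2 + ‖v.2.1‖ ^ 2 + ‖v.2.2‖ ^ 2)

/-- The second differential `d²H(z)[v, w]` of a function of `z = (t, q, p)`. -/
def secondDiff {d : ℕ} (H : ℝ × Space d × Space d → ℝ) (z v w : ℝ × Space d × Space d) : ℝ :=
  fderiv ℝ (fderiv ℝ H) z v w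

/-- The assumptions on the Hamiltonian `H(t, q, p)`, with constants `m` and `M`. -/
structure IsUniformlyConvexHamiltonian {d : ℕ} (m M : ℝ) (H : ℝ × Space d × Space d → ℝ) :
    Prop where
  contDiff : ContDiff ℝ 2 H
  m_pos : 0 < m
  /-- `‖d²H‖ ≤ M`, for the operator norm associated with the Euclidean norm. -/
  secondDiff_le : ∀ z v w, |secondDiff H z v w| ≤ M * (euclNorm v * euclNorm w)
  /-- `∂²H/∂p² ≥ m Id` in the sense of quadratic forms. -/
  convex_momentum : ∀ z, ∀ y : Space d, m * ‖y‖ ^ 2 ≤ secondDiff H z (0, 0, y) (0, 0, y)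
  lower_bound : ∀ t q p, m / 2 * ‖p‖ ^ 2 - M ≤ H (t, q, p)
  upper_bound : ∀ t q p, H (t, q, p) ≤ M / 2 * ‖p‖ ^ 2 + M

/-- `γ = (q, p)` is a solution, defined on the whole real line, of the Hamiltonian system
`q' = ∂H/∂p (s, q, p)`, `p' = -∂H/∂q (s, q, p)`. -/
def IsOrbit {d : ℕ} (H : ℝ × Space d × Space d → ℝ) (γ : ℝ → Space d × Space d) : Prop :=
  ∀ s : ℝ,
    HasDerivAt (fun r => (γ r).1) (gradient (fun p => H (s, (γ s).1, p)) (γ s).2) s ∧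
    HasDerivAt (fun r => (γ r).2) (-gradient (fun q => H (s, q, (γ s).2)) (γ s).1) s

/-- The flow map `φ_τ^t`: the value at time `t` of the solution that is equal to `x` at time `τ`.
When the second differential of `H` is bounded, there is exactly one such solution. -/
def flow {d : ℕ} (H : ℝ × Space d × Space d → ℝ) (τ t : ℝ) (x : Space d × Space d) :
    Space d × Space d :=
  Classical.epsilon (fun γ : ℝ → Space d × Space d => IsOrbit H γ ∧ γ τ = x) t

/-- The Hamiltonian action `∫ p · q' - H(s, q, p) ds` on the time interval `[a, b]` of the curve
`γ = (q, p)`. -/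
def action {d : ℕ} (H : ℝ × Space d × Space d → ℝ) (a b : ℝ) (γ : ℝ → Space d × Space d) : ℝ :=
  ∫ s in a..b, (⟪(γ s).2, deriv (fun r => (γ r).1) s⟫_ℝ - H (s, (γ s).1, (γ s).2))

/-- The generating function `S_a^b(q₀, q₁)`: the action of the orbit `(q, p)` such that
`q(a) = q₀` and `q(b) = q₁`, which is unique when `0 < b - a < twistTime m M`. -/
def generatingFunction {d : ℕ} (H : ℝ × Space d × Space d → ℝ) (a b : ℝ) (q₀ q₁ : Space d) : ℝ :=
  action H a b (Classical.epsilon fun γ : ℝ → Space d × Space d =>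
    IsOrbit H γ ∧ (γ a).1 = q₀ ∧ (γ b).1 = q₁)

/-- The constant `σ`, which depends only on `m` and `M`: for `0 < b - a < σ` any two points are
joined by exactly one orbit between the times `a` and `b`, and `S_a^b` is uniformly convex in each
of its variables. -/
def twistTime (m M : ℝ) : ℝ := m ^ 2 / (64 * M ^ 3)

/-- The minimal action `A_τ^t(q₀, q₁)`: the minimum over `θ₁, …, θₙ₋₁` of the sum of the
generating functions of `n` successive time intervals of length `(t - τ) / n`, at the points
`q₀ = θ₀, θ₁, …, θₙ = q₁` (the values of `θ` beyond `n` play no role). It does not depend on `n`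
provided `(t - τ) / n < twistTime m M`. -/
def minimalAction {d : ℕ} (H : ℝ × Space d × Space d → ℝ) (n : ℕ) (τ t : ℝ) (q₀ q₁ : Space d) :
    ℝ :=
  ⨅ θ : {θ : ℕ → Space d // θ 0 = q₀ ∧ θ n = q₁},
    ∑ i ∈ Finset.range n,
      generatingFunction H (τ + i * ((t - τ) / n)) (τ + (i + 1) * ((t - τ) / n))
        (θ.1 i) (θ.1 (i + 1))

/-- The Lax-Oleinik operator `T_τ^t`. -/
def laxOleinik {d : ℕ} (H : ℝ × Space d × Space d → ℝ) (n : ℕ) (τ t : ℝ) (u : Space d → ℝ) :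
    Space d → ℝ :=
  fun q => ⨅ θ : Space d, (u θ + minimalAction H n τ t θ q)

/-- The dual Lax-Oleinik operator `Ť_t^τ` (backward in time, from `t` to `τ`). -/
def dualLaxOleinik {d : ℕ} (H : ℝ × Space d × Space d → ℝ) (n : ℕ) (t τ : ℝ) (u : Space d → ℝ) :
    Space d → ℝ :=
  fun q => ⨆ θ : Space d, (u θ - minimalAction H n τ t q θ)

/-- `u` is `K`-semi-convex: `u + K|·|²` is convex. -/
def IsSemiConvex {d : ℕ} (K : ℝ) (u : Space d → ℝ) : Prop :=
  ConvexOn ℝ Set.univ (fun q => u q + K * ‖q‖ ^ 2)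

/-- `u` is `C^{1,1}`: differentiable with a (globally) Lipschitz differential. -/
def IsC11 {d : ℕ} (u : Space d → ℝ) : Prop :=
  Differentiable ℝ u ∧ ∃ C : NNReal, LipschitzWith C (fderiv ℝ u)

/-- `P` is a sub-differential of `u` at `Q`: there is a `C¹` function `v` with `dv(Q) = P` such
that `u - v` has a minimum at `Q`. -/
def IsSubDifferential {d : ℕ} (u : Space d → ℝ) (Q P : Space d) : Prop :=
  ∃ v : Space d → ℝ, ContDiff ℝ 1 v ∧ gradient v Q = P ∧ ∀ q, u Q - v Q ≤ u q - v q

/-- The set `L_u` of the points `(Q, P)` such that `P` is a sub-differential of `u` at `Q`. -/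
def subDifferentialGraph {d : ℕ} (u : Space d → ℝ) : Set (Space d × Space d) :=
  {x | IsSubDifferential u x.1 x.2}

/-- The graph `Γ_u` of the differential of `u` on its domain of definition. -/
def differentialGraph {d : ℕ} (u : Space d → ℝ) : Set (Space d × Space d) :=
  {x | DifferentiableAt ℝ u x.1 ∧ x.2 = gradient u x.1}

end WeakKAM

end

/-! The argument is a calibration. Along an orbit `x = (Q, P)` put `ψ_s(q) = ⟪P(s), q - Q(s)⟫ - k(s)
‖q - Q(s)‖²` with `k(s) = K + s r` (`calibration`). If `k' ≥ M/2 + 2kM + 4k²M`, the growth of `ψ_s`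
along any other orbit is at most the excess of its Lagrangian over that of `x` (`lagrangian_gap`,
`action_sub_action_ge`). Summing over the pieces of a broken orbit gives `A(q₀, q₁) ≥ action(x) +
ψ_t(q₁) - ψ_0(q₀)`, with equality when `q₀` and `q₁` are the ends of `x`. The choice `r = δ/(2t)`
satisfies the differential inequality exactly because `t ≤ T`, and gives `k(t) = K + δ/2`.

If `x` starts on the sub-differential graph of `u`, semi-convexity says `u ≥ u(Q(0)) + ψ_0`. Adding
this to the bound on `A` shows that `T_0^t u` lies above a paraboloid of curvature `k(t)` with slope
`P(t)`, touching it at `Q(t)`. It remains to see that such characteristics reach every point and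
that their slopes depend on the point in a Lipschitz way: paraboloids below at every point with
Lipschitz slopes force the function to be `C^{1,1}` with these slopes as gradient.

Both facts come from the strict form of the gap, which makes the transported graph strongly monotone
after adding `2k(t)` times the position (`exists_strong_monotonicity`). The Lipschitz bound is
immediate. For surjectivity, the initial graph is parametrized by `z = (1 + 2K) q + p` (Minty); the
flow moves this coordinate by a contraction, so it remains onto at time `t`, and in the new
coordinate the position is Lipschitz and strongly monotone, hence onto (`exists_characteristic`).

The dual identity is then elementary: `Ť T u ≤ u` always holds, and equality at `q` is seen on the
orbit issued from `(q, p)` for any sub-differential `p`. -/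

namespace WeakKAM

/-! ### Convex analysis and monotone maps -/

section ConvexAnalysis

variable {E : Type*} [NormedAddCommGroup E] [InnerProductSpace ℝ E]

/-- A lower bound on the monotonicity of the gradient gives a quadratic lower bound on the
function. -/
theorem quadratic_lower_bound {f : E → ℝ} {f' : E → E →L[ℝ] ℝ}
    (hf : ∀ x, HasFDerivAt f (f' x) x) {c : ℝ}
    (hc : ∀ x v, c * ‖v‖ ^ 2 ≤ (f' (x + v) - f' x) v) (x v : E) :
    f x + f' x v + c / 2 * ‖v‖ ^ 2 ≤ f (x + v) := by
  have hline : ∀ s : ℝ, HasDerivAt (fun r : ℝ => x + r • v) v s := fun s => by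
    simpa using ((hasDerivAt_id s).smul_const v).const_add x
  have hg : ∀ s : ℝ, HasDerivAt
      (fun r : ℝ => f (x + r • v) - r * f' x v - c / 2 * ‖v‖ ^ 2 * r ^ 2)
      (f' (x + s • v) v - f' x v - c / 2 * ‖v‖ ^ 2 * (2 * s)) s := by
    intro s
    have h1 := (hf (x + s • v)).comp_hasDerivAt s (hline s)
    have h2 := (hasDerivAt_id s).mul_const (f' x v)
    have h3 := (hasDerivAt_pow 2 s).const_mul (c / 2 * ‖v‖ ^ 2)
    refine ((h1.sub h2).sub h3).congr_deriv ?_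
    simp
  have hmono : MonotoneOn
      (fun r : ℝ => f (x + r • v) - r * f' x v - c / 2 * ‖v‖ ^ 2 * r ^ 2) (Set.Icc 0 1) := by
    refine monotoneOn_of_deriv_nonneg (convex_Icc 0 1)
      (fun s _ => (hg s).continuousAt.continuousWithinAt)
      (fun s _ => (hg s).differentiableAt.differentiableWithinAt) fun s hs => ?_
    rw [interior_Icc] at hs
    rw [(hg s).deriv]
    have h := hc x (s • v)
    rw [norm_smul, Real.norm_of_nonneg hs.1.le, map_smul, smul_eq_mul, sub_apply] at h
    have : s * (c * ‖v‖ ^ 2 * s) ≤ s * (f' (x + s • v) v - f' x v) := by linarith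
    have := le_of_mul_le_mul_left this hs.1
    linarith
  have := hmono (Set.left_mem_Icc.2 zero_le_one) (Set.right_mem_Icc.2 zero_le_one) zero_le_one
  simp only [zero_smul, one_smul, add_zero] at this
  linarith

/-- Co-coercivity (Baillon-Haddad): for a convex function whose gradient is `M`-Lipschitz, the
Bregman divergence controls the variation of the gradient. -/
theorem bregman_cocoercive {f : E → ℝ} {g : E → E}
    (hf : ∀ x, HasFDerivAt f (innerSL ℝ (g x)) x) {M : ℝ} (hM : 0 < M)
    (hmono : ∀ x v, 0 ≤ ⟪g (x + v) - g x, v⟫_ℝ)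
    (hlip : ∀ x v, ⟪g (x + v) - g x, v⟫_ℝ ≤ M * ‖v‖ ^ 2) (x v : E) :
    f x + ⟪g x, v⟫_ℝ + 1 / (2 * M) * ‖g (x + v) - g x‖ ^ 2 ≤ f (x + v) := by
  -- A gradient step of length `1/M` from `x + v` for `f` minus its tangent at `x`: it minimizes the
  -- quadratic upper bound at `x + v`, while convexity keeps `f` above the tangent at `x`.
  set w : E := -((1 / M) • (g (x + v) - g x)) with hw
  have h1 := quadratic_lower_bound hf (c := 0)
    (fun a b => by simpa [inner_sub_left] using hmono a b) x (v + w)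
  have h2 := quadratic_lower_bound (f := fun y => -f y) (f' := fun y => -innerSL ℝ (g y))
    (fun a => (hf a).neg) (c := -M)
    (fun a b => by
      have := hlip a b
      simp only [inner_sub_left] at this
      simp only [neg_sub_neg, sub_apply, innerSL_apply_apply]
      linarith) (x + v) w
  have hww : ‖w‖ ^ 2 = 1 / M ^ 2 * ‖g (x + v) - g x‖ ^ 2 := by
    rw [hw, norm_neg, norm_smul, mul_pow, Real.norm_of_nonneg (by positivity)]
    ring
  have hgw : ⟪g (x + v), w⟫_ℝ = ⟪g x, w⟫_ℝ - 1 / M * ‖g (x + v) - g x‖ ^ 2 := by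
    have : ⟪g (x + v) - g x, w⟫_ℝ = -(1 / M * ‖g (x + v) - g x‖ ^ 2) := by
      rw [hw, inner_neg_right, inner_smul_right, real_inner_self_eq_norm_sq]
    rw [inner_sub_left] at this
    linarith
  rw [← add_assoc] at h1
  simp only [innerSL_apply_apply, inner_add_right, neg_apply, hww, hgw] at h1 h2
  have e : 1 / (2 * M) * ‖g (x + v) - g x‖ ^ 2 = 1 / M * ‖g (x + v) - g x‖ ^ 2
      - M / 2 * (1 / M ^ 2 * ‖g (x + v) - g x‖ ^ 2) := by
    field_simp
    ring
  rw [e]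
  linarith

/-- A convex function lies above the tangent hyperplane of any differentiable function that touches
it from below. -/
theorem ConvexOn.le_of_touching {f w : E → ℝ} (hf : ConvexOn ℝ Set.univ f) {x : E}
    {w' : E →L[ℝ] ℝ} (hw : HasFDerivAt w w' x) (hmin : ∀ y, f x - w x ≤ f y - w y) (y : E) :
    f x + w' (y - x) ≤ f y := by
  have hline : HasDerivAt (fun r : ℝ => x + r • (y - x)) (y - x) 0 := by
    simpa using ((hasDerivAt_id (0 : ℝ)).smul_const (y - x)).const_add x
  have hw0 : HasFDerivAt w w' (x + (0 : ℝ) • (y - x)) := by simpa using hw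
  have hd := hw0.comp_hasDerivAt (0 : ℝ) hline
  have hlim := hd.tendsto_slope_zero_right
  refine le_sub_iff_add_le'.1 (le_of_tendsto hlim ?_)
  filter_upwards [Ioo_mem_nhdsGT (zero_lt_one' ℝ)] with r hr
  have h1 := hf.2 (Set.mem_univ x) (Set.mem_univ y) (sub_nonneg.2 hr.2.le) hr.1.le (by ring)
  have h2 := hmin (x + r • (y - x))
  rw [show (1 - r) • x + r • y = x + r • (y - x) by module] at h1
  simp only [smul_eq_mul] at h1
  simp only [Function.comp, zero_add, zero_smul, add_zero, smul_eq_mul]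
  rw [inv_mul_le_iff₀ hr.1]
  linarith

/-- Existence of a subgradient of a convex function on a finite dimensional space. -/
theorem ConvexOn.exists_subgradient [FiniteDimensional ℝ E] {f : E → ℝ}
    (hf : ConvexOn ℝ Set.univ f) (x : E) : ∃ g : E, ∀ y, f x + ⟪g, y - x⟫_ℝ ≤ f y := by
  have hcont : Continuous f := hf.locallyLipschitz.continuous
  have hopen : IsOpen {z : E × ℝ | f z.1 < z.2} :=
    isOpen_lt (hcont.comp continuous_fst) continuous_snd
  have hconv : Convex ℝ {z : E × ℝ | f z.1 < z.2} := by
    simpa using hf.convex_strict_epigraph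
  obtain ⟨φ, hφ⟩ := geometric_hahn_banach_open_point hconv hopen (x := (x, f x)) (by simp)
  have hsplit : ∀ (y : E) (r : ℝ), φ (y, r) = φ (y, 0) + r * φ (0, 1) := fun y r => by
    rw [← smul_eq_mul, ← map_smul, ← map_add]
    simp
  have hneg : φ (0, 1) < 0 := by
    have := hφ (x, f x + 1) (by simp)
    rw [hsplit x (f x + 1), hsplit x (f x)] at this
    linarith
  let ψ : E →L[ℝ] ℝ := (-(φ (0, 1)))⁻¹ • φ.comp (ContinuousLinearMap.inl ℝ E ℝ)
  have : CompleteSpace E := FiniteDimensional.complete ℝ E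
  refine ⟨(InnerProductSpace.toDual ℝ E).symm ψ, fun y => ?_⟩
  rw [InnerProductSpace.toDual_symm_apply]
  have hle : φ (y, f y) ≤ φ (x, f x) := by
    have hlim : Filter.Tendsto (fun r : ℝ => φ (y, r)) (nhdsWithin (f y) (Set.Ioi (f y)))
        (nhds (φ (y, f y))) := by
      refine Filter.Tendsto.mono_left ?_ nhdsWithin_le_nhds
      exact (φ.continuous.comp (by fun_prop : Continuous fun r : ℝ => (y, r))).tendsto (f y)
    refine le_of_tendsto hlim ?_
    filter_upwards [self_mem_nhdsWithin] with r hr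
    exact (hφ (y, r) hr).le
  rw [hsplit y, hsplit x] at hle
  have e : ψ (y - x) = (φ (y, 0) - φ (x, 0)) / (-(φ (0, 1))) := by
    rw [← map_sub]
    simp [ψ, div_eq_inv_mul]
  have : (φ (y, 0) - φ (x, 0)) / (-(φ (0, 1))) ≤ f y - f x := by
    rw [div_le_iff₀ (by linarith)]
    linarith
  rw [e]
  linarith

/-- Minty parametrization: the proximal map of a convex function is defined everywhere. -/
theorem ConvexOn.exists_proximal_point [FiniteDimensional ℝ E] {f : E → ℝ}
    (hf : ConvexOn ℝ Set.univ f) (z : E) : ∃ x : E, ∀ y, f x + ⟪z - x, y - x⟫_ℝ ≤ f y := by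
  have hcont : Continuous f := hf.locallyLipschitz.continuous
  obtain ⟨g, hg⟩ := ConvexOn.exists_subgradient hf z
  have : ProperSpace E := FiniteDimensional.proper ℝ E
  have hlim : Filter.Tendsto (fun y => f y + 1 / 2 * ‖y - z‖ ^ 2) (Filter.cocompact E)
      Filter.atTop := by
    have h1 : Filter.Tendsto (fun y : E => ‖y - z‖) (Filter.cocompact E) Filter.atTop := by
      refine Filter.tendsto_atTop_mono (fun y => norm_sub_norm_le y z) ?_
      exact Filter.tendsto_atTop_add_const_right _ _ tendsto_norm_cocompact_atTop
    have h2 : Filter.Tendsto (fun r : ℝ => r + (f z - 1 / 2 * (‖g‖ + 1) ^ 2))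
        Filter.atTop Filter.atTop := Filter.tendsto_atTop_add_const_right _ _ Filter.tendsto_id
    -- A convex function decreases at most linearly, so the quadratic term wins; the constant comes
    -- from completing the square around `‖g‖ + 1`.
    refine Filter.tendsto_atTop_mono (fun y => ?_) (h2.comp h1)
    have h3 := hg y
    have h4 := (abs_le.1 (abs_real_inner_le_norm g (y - z))).1
    simp only [Function.comp]
    nlinarith [sq_nonneg (‖y - z‖ - (‖g‖ + 1))]
  obtain ⟨x, hx⟩ := Continuous.exists_forall_le
    (f := fun y => f y + 1 / 2 * ‖y - z‖ ^ 2) (by fun_prop) hlim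
  -- At the minimizer `x`, the concave paraboloid `-‖· - z‖²/2`, whose slope there is `z - x`,
  -- touches `f` from below up to a constant.
  have hd : HasFDerivAt (fun y => -(1 / 2 * ‖y - z‖ ^ 2)) (innerSL ℝ (z - x)) x := by
    have h := ((((hasFDerivAt_id x).sub_const z).norm_sq).const_mul (1 / 2 : ℝ)).neg
    refine h.congr_fderiv ?_
    ext v
    simp
  have hmin : ∀ y, f x - -(1 / 2 * ‖x - z‖ ^ 2) ≤ f y - -(1 / 2 * ‖y - z‖ ^ 2) := fun y => by
    have := hx y
    linarith
  exact ⟨x, ConvexOn.le_of_touching hf hd hmin⟩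

/-- A perturbation of the identity by a contraction is onto. -/
theorem surjective_of_sub_id_contracting {F : Type*} [NormedAddCommGroup F] [CompleteSpace F]
    {Φ : F → F} {κ : ℝ} (hκ : κ < 1)
    (h : ∀ x y, ‖(Φ x - Φ y) - (x - y)‖ ≤ κ * ‖x - y‖) : Function.Surjective Φ := by
  intro y
  have hc : ContractingWith (Real.toNNReal κ) fun x => x - Φ x + y := by
    refine ⟨by simpa using hκ, LipschitzWith.of_dist_le_mul fun a b => ?_⟩
    rw [dist_eq_norm, dist_eq_norm,
      show a - Φ a + y - (b - Φ b + y) = -((Φ a - Φ b) - (a - b)) by abel, norm_neg]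
    exact (h a b).trans (by gcongr; exact Real.le_coe_toNNReal κ)
  refine ⟨hc.fixedPoint, ?_⟩
  have := hc.fixedPoint_isFixedPt
  simp only [Function.IsFixedPt] at this
  have h2 : y - Φ hc.fixedPoint = 0 := by
    rw [← sub_eq_zero] at this
    rw [← this]
    abel
  exact (sub_eq_zero.1 h2).symm

/-- Zarantonello: a Lipschitz strongly monotone map is onto. -/
theorem surjective_of_strongly_monotone [CompleteSpace E] {Φ : E → E} {c L : ℝ} (hc : 0 < c)
    (hmono : ∀ x y, c * ‖x - y‖ ^ 2 ≤ ⟪Φ x - Φ y, x - y⟫_ℝ)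
    (hlip : ∀ x y, ‖Φ x - Φ y‖ ≤ L * ‖x - y‖) : Function.Surjective Φ := by
  -- A step for which `id - ηΦ` has squared Lipschitz constant at most `1 - 2ηc + η²L² ≤ 1 - ηc`.
  -- The `c²` in the denominator keeps `1 - ηc` nonnegative and covers `L = 0`.
  set η : ℝ := c / (L ^ 2 + c ^ 2) with hη
  have hpos : 0 < L ^ 2 + c ^ 2 := by positivity
  have hη0 : 0 < η := by positivity
  set κ : ℝ := Real.sqrt (1 - η * c) with hκ
  have hηc : η * (L ^ 2 + c ^ 2) = c := by rw [hη]; field_simp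
  have hle : 0 ≤ 1 - η * c := by
    have : η * c = c ^ 2 / (L ^ 2 + c ^ 2) := by rw [hη]; ring
    rw [this, sub_nonneg, div_le_one hpos]
    nlinarith [sq_nonneg L]
  have hsurj : Function.Surjective fun x => η • Φ x := by
    refine surjective_of_sub_id_contracting (κ := κ) ?_ fun x y => ?_
    · rw [hκ, Real.sqrt_lt' one_pos]
      nlinarith [mul_pos hη0 hc]
    · rw [← smul_sub]
      refine le_of_sq_le_sq ?_ (by positivity)
      rw [mul_pow, hκ, Real.sq_sqrt hle, norm_sub_sq_real, norm_smul, real_inner_smul_left,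
        Real.norm_of_nonneg hη0.le]
      have h1 := hmono x y
      have h2 : ‖Φ x - Φ y‖ ^ 2 ≤ (L * ‖x - y‖) ^ 2 :=
        pow_le_pow_left₀ (norm_nonneg _) (hlip x y) 2
      have h3 : η * (c * ‖x - y‖ ^ 2) ≤ η * ⟪Φ x - Φ y, x - y⟫_ℝ :=
        mul_le_mul_of_nonneg_left h1 hη0.le
      have h4 : η ^ 2 * ‖Φ x - Φ y‖ ^ 2 ≤ η * (η * (L ^ 2 + c ^ 2)) * ‖x - y‖ ^ 2 := by
        have : η ^ 2 * ‖Φ x - Φ y‖ ^ 2 ≤ η ^ 2 * (L * ‖x - y‖) ^ 2 :=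
          mul_le_mul_of_nonneg_left h2 (by positivity)
        nlinarith [mul_nonneg (sq_nonneg (η * c)) (sq_nonneg ‖x - y‖)]
      rw [hηc] at h4
      nlinarith
  intro y
  obtain ⟨x, hx⟩ := hsurj (η • y)
  exact ⟨x, smul_right_injective E hη0.ne' hx⟩

/-- A function with quadratic lower bounds at all points, whose slopes form a Lipschitz map, is
differentiable, and its derivative is given by the slopes. -/
theorem hasFDerivAt_of_quadratic_support {w : E → ℝ} {g : E → E} {k C : ℝ}
    (hw : ∀ x y, w x + ⟪g x, y - x⟫_ℝ - k * ‖y - x‖ ^ 2 ≤ w y)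
    (hg : ∀ x y, ‖g x - g y‖ ≤ C * ‖x - y‖) (x : E) :
    HasFDerivAt w (innerSL ℝ (g x)) x := by
  refine HasFDerivAt.of_isLittleO ?_
  -- The paraboloid at `x` bounds the remainder from below; the one at `y`, with its slope moved
  -- back to `g x`, bounds it from above.
  have hO : (fun y => w y - w x - innerSL ℝ (g x) (y - x)) =O[nhds x]
      fun y => ‖y - x‖ ^ 2 := by
    refine Asymptotics.IsBigO.of_bound (|k| + C) (Filter.Eventually.of_forall fun y => ?_)
    have h1 := hw x y
    have h2 := hw y x
    have h3 : ⟪g y, x - y⟫_ℝ = -⟪g x, y - x⟫_ℝ - ⟪g y - g x, y - x⟫_ℝ := by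
      rw [← neg_sub y x, inner_neg_right, inner_sub_left]
      ring
    have h4 : ⟪g y - g x, y - x⟫_ℝ ≤ C * ‖y - x‖ ^ 2 := by
      refine (real_inner_le_norm _ _).trans ?_
      have := mul_le_mul_of_nonneg_right (hg y x) (norm_nonneg (y - x))
      linarith
    have h5 : 0 ≤ C * ‖y - x‖ ^ 2 := by
      have := mul_nonneg ((norm_nonneg _).trans (hg y x)) (norm_nonneg (y - x))
      linarith
    have h6 := mul_le_mul_of_nonneg_right (le_abs_self k) (sq_nonneg ‖y - x‖)
    rw [norm_sub_rev x y] at h2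
    rw [innerSL_apply_apply, Real.norm_eq_abs, Real.norm_of_nonneg (by positivity), abs_le]
    constructor <;> linarith
  refine hO.trans_isLittleO ?_
  have := Asymptotics.isLittleO_norm_pow_id (E' := E) one_lt_two
  have h2 := this.comp_tendsto (show Filter.Tendsto (fun y => y - x) (nhds x) (nhds 0) by
    simpa using (continuous_id.sub continuous_const).tendsto (x := x) (f := fun y => y - x))
  exact h2

/-- Adding `k‖·‖²` turns each supporting paraboloid into a supporting hyperplane, and a function
with a supporting hyperplane at every point is convex. -/
theorem convexOn_of_quadratic_support {w : E → ℝ} {g : E → E} {k : ℝ}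
    (hw : ∀ x y, w x + ⟪g x, y - x⟫_ℝ - k * ‖y - x‖ ^ 2 ≤ w y) :
    ConvexOn ℝ Set.univ fun x => w x + k * ‖x‖ ^ 2 := by
  refine ⟨convex_univ, fun x _ y _ a b ha hb hab => ?_⟩
  have key : ∀ x y, w x + k * ‖x‖ ^ 2 + ⟪g x + (2 * k) • x, y - x⟫_ℝ ≤ w y + k * ‖y‖ ^ 2 := by
    intro x y
    have h := hw x y
    rw [inner_add_left, real_inner_smul_left]
    have e : ‖y - x‖ ^ 2 = ‖y‖ ^ 2 - ‖x‖ ^ 2 - 2 * ⟪x, y - x⟫_ℝ := by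
      rw [norm_sub_sq_real, inner_sub_right, real_inner_self_eq_norm_sq, real_inner_comm]
      ring
    rw [e] at h
    linarith
  obtain rfl : b = 1 - a := by linarith
  set p : E := a • x + (1 - a) • y with hp
  set r : E := g p + (2 * k) • p
  have h1 := mul_le_mul_of_nonneg_left (key p x) ha
  have h2 := mul_le_mul_of_nonneg_left (key p y) hb
  have e : a * ⟪r, x - p⟫_ℝ + (1 - a) * ⟪r, y - p⟫_ℝ = 0 := by
    rw [← real_inner_smul_right, ← real_inner_smul_right, ← inner_add_right,
      show a • (x - p) + (1 - a) • (y - p) = 0 by rw [hp]; module, inner_zero_right]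
  simp only [smul_eq_mul]
  linarith

end ConvexAnalysis

/-! ### Partial gradients of the Hamiltonian and the pointwise Lagrangian gap -/

section Hamiltonian

variable {d : ℕ} {m M : ℝ} {H : ℝ × Space d × Space d → ℝ}

/-- The partial gradient `∂H/∂q`. -/
noncomputable def gradQ (H : ℝ × Space d × Space d → ℝ) (z : ℝ × Space d × Space d) : Space d :=
  gradient (fun q => H (z.1, q, z.2.2)) z.2.1

/-- The partial gradient `∂H/∂p`. -/
noncomputable def gradP (H : ℝ × Space d × Space d → ℝ) (z : ℝ × Space d × Space d) : Space d :=
  gradient (fun p => H (z.1, z.2.1, p)) z.2.2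

theorem hasFDerivAt_position (hd : Differentiable ℝ H) (s : ℝ) (q p : Space d) :
    HasFDerivAt (fun q => H (s, q, p)) (innerSL ℝ (gradQ H (s, q, p))) q := by
  have h : DifferentiableAt ℝ (fun q => H (s, q, p)) q := by fun_prop
  exact h.hasGradientAt.hasFDerivAt

theorem hasFDerivAt_momentum (hd : Differentiable ℝ H) (s : ℝ) (q p : Space d) :
    HasFDerivAt (fun p => H (s, q, p)) (innerSL ℝ (gradP H (s, q, p))) p := by
  have h : DifferentiableAt ℝ (fun p => H (s, q, p)) p := by fun_prop
  exact h.hasGradientAt.hasFDerivAt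

theorem inner_gradQ (hd : Differentiable ℝ H) (z : ℝ × Space d × Space d) (y : Space d) :
    ⟪gradQ H z, y⟫_ℝ = fderiv ℝ H z (0, y, 0) := by
  have h1 : HasFDerivAt (fun q : Space d => (z.1, q, z.2.2))
      (ContinuousLinearMap.prod 0 ((ContinuousLinearMap.id ℝ _).prod 0)) z.2.1 :=
    (hasFDerivAt_const _ _).prodMk ((hasFDerivAt_id _).prodMk (hasFDerivAt_const _ _))
  have h2 := (hd (z.1, z.2.1, z.2.2)).hasFDerivAt.comp z.2.1 h1
  have h3 := congrArg (fun φ => φ y) ((hasFDerivAt_position hd z.1 z.2.1 z.2.2).unique h2)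
  simpa using h3

theorem inner_gradP (hd : Differentiable ℝ H) (z : ℝ × Space d × Space d) (y : Space d) :
    ⟪gradP H z, y⟫_ℝ = fderiv ℝ H z (0, 0, y) := by
  have h1 : HasFDerivAt (fun p : Space d => (z.1, z.2.1, p))
      (ContinuousLinearMap.prod 0 (ContinuousLinearMap.prod 0 (ContinuousLinearMap.id ℝ _)))
      z.2.2 :=
    (hasFDerivAt_const _ _).prodMk ((hasFDerivAt_const _ _).prodMk (hasFDerivAt_id _))
  have h2 := (hd (z.1, z.2.1, z.2.2)).hasFDerivAt.comp z.2.2 h1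
  have h3 := congrArg (fun φ => φ y) ((hasFDerivAt_momentum hd z.1 z.2.1 z.2.2).unique h2)
  simpa using h3

theorem gradQ_eq (hd : Differentiable ℝ H) : gradQ H = fun z =>
    (InnerProductSpace.toDual ℝ (Space d)).symm ((fderiv ℝ H z).comp
      ((ContinuousLinearMap.inr ℝ ℝ _).comp (ContinuousLinearMap.inl ℝ (Space d) (Space d)))) := by
  funext z
  refine ext_inner_right ℝ fun y => ?_
  rw [inner_gradQ hd, InnerProductSpace.toDual_symm_apply]
  simp

theorem gradP_eq (hd : Differentiable ℝ H) : gradP H = fun z =>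
    (InnerProductSpace.toDual ℝ (Space d)).symm ((fderiv ℝ H z).comp
      ((ContinuousLinearMap.inr ℝ ℝ _).comp (ContinuousLinearMap.inr ℝ (Space d) (Space d)))) := by
  funext z
  refine ext_inner_right ℝ fun y => ?_
  rw [inner_gradP hd, InnerProductSpace.toDual_symm_apply]
  simp

theorem contDiff_gradQ (h : ContDiff ℝ 2 H) : ContDiff ℝ 1 (gradQ H) := by
  rw [gradQ_eq (h.differentiable (by norm_num))]
  have h1 : ContDiff ℝ 1 (fderiv ℝ H) := h.fderiv_right (by norm_num)
  exact (InnerProductSpace.toDual ℝ (Space d)).symm.contDiff.comp (h1.clm_comp contDiff_const)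

theorem contDiff_gradP (h : ContDiff ℝ 2 H) : ContDiff ℝ 1 (gradP H) := by
  rw [gradP_eq (h.differentiable (by norm_num))]
  have h1 : ContDiff ℝ 1 (fderiv ℝ H) := h.fderiv_right (by norm_num)
  exact (InnerProductSpace.toDual ℝ (Space d)).symm.contDiff.comp (h1.clm_comp contDiff_const)

theorem hasDerivAt_fderiv_line (h : ContDiff ℝ 2 H) (z v w : ℝ × Space d × Space d) (s : ℝ) :
    HasDerivAt (fun r : ℝ => fderiv ℝ H (z + r • v) w) (secondDiff H (z + s • v) v w) s := by
  have h1 : ContDiff ℝ 1 (fderiv ℝ H) := h.fderiv_right (by norm_num)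
  have h2 : HasDerivAt (fun r : ℝ => z + r • v) v s := by
    simpa using ((hasDerivAt_id s).smul_const v).const_add z
  have h3 := ((h1.differentiable (by norm_num)) (z + s • v)).hasFDerivAt.comp_hasDerivAt s h2
  refine (h3.clm_apply (hasDerivAt_const s w)).congr_deriv ?_
  simp [secondDiff]

namespace IsUniformlyConvexHamiltonian

variable (hH : IsUniformlyConvexHamiltonian m M H)

include hH

theorem differentiable : Differentiable ℝ H := hH.contDiff.differentiable (by norm_num)

theorem abs_fderiv_sub_le (z v w : ℝ × Space d × Space d) :
    |fderiv ℝ H (z + v) w - fderiv ℝ H z w| ≤ M * (euclNorm v * euclNorm w) := by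
  have := norm_image_sub_le_of_norm_deriv_le_segment_01'
    (f := fun r : ℝ => fderiv ℝ H (z + r • v) w)
    (fun s _ => (hasDerivAt_fderiv_line hH.contDiff z v w s).hasDerivWithinAt)
    (fun s _ => hH.secondDiff_le (z + s • v) v w)
  simpa using this

theorem le_fderiv_sub (z : ℝ × Space d × Space d) (y : Space d) :
    m * ‖y‖ ^ 2 ≤ fderiv ℝ H (z + (0, 0, y)) (0, 0, y) - fderiv ℝ H z (0, 0, y) := by
  have hd := hasDerivAt_fderiv_line hH.contDiff z (0, 0, y) (0, 0, y)
  have := mul_sub_le_image_sub_of_le_deriv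
    (f := fun r : ℝ => fderiv ℝ H (z + r • (0, 0, y)) (0, 0, y))
    (fun s => (hd s).differentiableAt) (C := m * ‖y‖ ^ 2)
    (fun s => by rw [(hd s).deriv]; exact hH.convex_momentum _ y) (zero_le_one (α := ℝ))
  simpa using this

theorem norm_gradQ_sub_le (hM : 0 < M) (z v : ℝ × Space d × Space d) :
    ‖gradQ H (z + v) - gradQ H z‖ ≤ M * euclNorm v := by
  set y := gradQ H (z + v) - gradQ H z
  have h := (le_abs_self _).trans (hH.abs_fderiv_sub_le z v (0, y, 0))
  rw [← inner_gradQ hH.differentiable, ← inner_gradQ hH.differentiable, ← inner_sub_left,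
    real_inner_self_eq_norm_sq] at h
  have e : euclNorm ((0 : ℝ), y, (0 : Space d)) = ‖y‖ := by simp [euclNorm]
  rw [e] at h
  by_cases hy : ‖y‖ = 0
  · rw [hy]
    exact mul_nonneg hM.le (Real.sqrt_nonneg _)
  · have hpos : 0 < ‖y‖ := lt_of_le_of_ne (norm_nonneg _) (Ne.symm hy)
    refine le_of_mul_le_mul_right ?_ hpos
    linarith

theorem norm_gradP_sub_le (hM : 0 < M) (z v : ℝ × Space d × Space d) :
    ‖gradP H (z + v) - gradP H z‖ ≤ M * euclNorm v := by
  set y := gradP H (z + v) - gradP H z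
  have h := (le_abs_self _).trans (hH.abs_fderiv_sub_le z v (0, 0, y))
  rw [← inner_gradP hH.differentiable, ← inner_gradP hH.differentiable, ← inner_sub_left,
    real_inner_self_eq_norm_sq] at h
  have e : euclNorm ((0 : ℝ), (0 : Space d), y) = ‖y‖ := by simp [euclNorm]
  rw [e] at h
  by_cases hy : ‖y‖ = 0
  · rw [hy]
    exact mul_nonneg hM.le (Real.sqrt_nonneg _)
  · have hpos : 0 < ‖y‖ := lt_of_le_of_ne (norm_nonneg _) (Ne.symm hy)
    refine le_of_mul_le_mul_right ?_ hpos
    linarith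

theorem strongly_monotone_gradP (s : ℝ) (q p y : Space d) :
    m * ‖y‖ ^ 2 ≤ ⟪gradP H (s, q, p + y) - gradP H (s, q, p), y⟫_ℝ := by
  have h := hH.le_fderiv_sub (s, q, p) y
  rw [inner_sub_left, inner_gradP hH.differentiable, inner_gradP hH.differentiable]
  simpa using h

/-- The comparison of the Lagrangian along two trajectories, at a given time: `x` is the reference
trajectory and `y` is the other one. -/
theorem lagrangian_gap (hM : 0 < M) {k : ℝ} (hk : 0 ≤ k) (κ s : ℝ) (q p q' p' : Space d) :
    m / 4 * ‖p' - p‖ ^ 2 + (κ - M / 2 - 2 * k * M - 4 * k ^ 2 * M) * ‖q' - q‖ ^ 2 ≤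
      ⟪p' - p, gradP H (s, q', p')⟫_ℝ - H (s, q', p') + H (s, q, p)
        + ⟪gradQ H (s, q, p), q' - q⟫_ℝ + κ * ‖q' - q‖ ^ 2
        + 2 * k * ⟪q' - q, gradP H (s, q', p') - gradP H (s, q, p)⟫_ℝ := by
  have hmono : ∀ a b : Space d, m * ‖b‖ ^ 2 ≤
      ⟪gradP H (s, q', a + b) - gradP H (s, q', a), b⟫_ℝ :=
    fun a b => hH.strongly_monotone_gradP s q' a b
  -- `hA` and `hB` bound the same Bregman divergence of `H(s, q', ·)` from below. Half of each is
  -- used: `hA` leaves `m/4 ‖p' - p‖²`, and `hB` leaves `1/(4M) ‖v‖²`, which absorbs the cross term.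
  -- Thanks to co-coercivity the condition on `κ` does not involve `m`.
  have hA := quadratic_lower_bound (fun a => hasFDerivAt_momentum hH.differentiable s q' a)
    (c := m) (fun a b => by simpa [inner_sub_left] using hmono a b) p' (p - p')
  have hB := bregman_cocoercive (fun a => hasFDerivAt_momentum hH.differentiable s q' a) hM
    (fun a b => (mul_nonneg hH.m_pos.le (sq_nonneg _)).trans (hmono a b))
    (fun a b => by
      refine (real_inner_le_norm _ _).trans ?_
      have h := hH.norm_gradP_sub_le hM (s, q', a) (0, 0, b)
      have e : euclNorm ((0 : ℝ), (0 : Space d), b) = ‖b‖ := by simp [euclNorm]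
      rw [e] at h
      have h2 := mul_le_mul_of_nonneg_right h (norm_nonneg b)
      simp only [Prod.mk_add_mk, add_zero] at h2
      linarith) p' (p - p')
  have hC := quadratic_lower_bound (f := fun a => -H (s, a, p))
    (f' := fun a => -innerSL ℝ (gradQ H (s, a, p)))
    (fun a => (hasFDerivAt_position hH.differentiable s a p).neg) (c := -M)
    (fun a b => by
      have h := hH.norm_gradQ_sub_le hM (s, a, p) (0, b, 0)
      have e : euclNorm ((0 : ℝ), b, (0 : Space d)) = ‖b‖ := by simp [euclNorm]
      rw [e] at h
      have h2 := mul_le_mul_of_nonneg_right h (norm_nonneg b)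
      have h3 := real_inner_le_norm (gradQ H (s, a + b, p) - gradQ H (s, a, p)) b
      simp only [Prod.mk_add_mk, add_zero] at h2
      rw [inner_sub_left] at h3
      simp only [neg_sub_neg, sub_apply, innerSL_apply_apply]
      linarith) q (q' - q)
  have hD := hH.norm_gradP_sub_le hM (s, q, p) (0, q' - q, 0)
  have e : euclNorm ((0 : ℝ), q' - q, (0 : Space d)) = ‖q' - q‖ := by simp [euclNorm]
  rw [e] at hD
  simp only [Prod.mk_add_mk, add_zero, add_sub_cancel, innerSL_apply_apply, neg_apply]
    at hA hB hC hD
  rw [norm_sub_rev p p'] at hA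
  -- The velocity difference is split at `(q', p)`: the change in `q` costs `M‖q' - q‖`, and the
  -- change in `p` is controlled by `hB`.
  have hsplit : ⟪q' - q, gradP H (s, q', p') - gradP H (s, q, p)⟫_ℝ =
      ⟪q' - q, gradP H (s, q', p) - gradP H (s, q, p)⟫_ℝ
        - ⟪q' - q, gradP H (s, q', p) - gradP H (s, q', p')⟫_ℝ := by
    rw [← inner_sub_right]
    congr 1
    abel
  have hflip : ⟪gradP H (s, q', p'), p - p'⟫_ℝ = -⟪p' - p, gradP H (s, q', p')⟫_ℝ := by
    rw [← inner_neg_left, neg_sub, real_inner_comm]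
  rw [hflip] at hA hB
  rw [hsplit]
  set v := gradP H (s, q', p) - gradP H (s, q', p')
  set w := gradP H (s, q', p) - gradP H (s, q, p)
  have h1 : -(M * ‖q' - q‖ ^ 2) ≤ ⟪q' - q, w⟫_ℝ := by
    have := (abs_le.1 (abs_real_inner_le_norm (q' - q) w)).1
    have := mul_le_mul_of_nonneg_left hD (norm_nonneg (q' - q))
    linarith
  have h2 : ⟪q' - q, v⟫_ℝ ≤ ‖q' - q‖ * ‖v‖ := real_inner_le_norm _ _
  have h3 : 2 * k * (‖q' - q‖ * ‖v‖) ≤ 1 / (4 * M) * ‖v‖ ^ 2 + 4 * k ^ 2 * M * ‖q' - q‖ ^ 2 := by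
    have : 0 ≤ 1 / (4 * M) * (‖v‖ - 4 * k * M * ‖q' - q‖) ^ 2 := by positivity
    have e : 1 / (4 * M) * (‖v‖ - 4 * k * M * ‖q' - q‖) ^ 2 =
        1 / (4 * M) * ‖v‖ ^ 2 + 4 * k ^ 2 * M * ‖q' - q‖ ^ 2 - 2 * k * (‖q' - q‖ * ‖v‖) := by
      field_simp
      ring
    linarith
  have h4 := mul_le_mul_of_nonneg_left h1 (by positivity : 0 ≤ 2 * k)
  have h5 := mul_le_mul_of_nonneg_left h2 (by positivity : 0 ≤ 2 * k)
  have h6 : 1 / (2 * M) * ‖v‖ ^ 2 = 2 * (1 / (4 * M) * ‖v‖ ^ 2) := by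
    field_simp
    ring
  rw [h6] at hB
  linarith

end IsUniformlyConvexHamiltonian

end Hamiltonian

/-! ### Global existence, uniqueness and Gronwall estimates for the flow -/

open scoped Manifold in
/-- A globally Lipschitz `C¹` vector field has global integral curves. -/
theorem exists_global_solution {E : Type*} [NormedAddCommGroup E] [NormedSpace ℝ E]
    [CompleteSpace E] {F : E → E} (hF : ContDiff ℝ 1 F) {K : NNReal} (hK : LipschitzWith K F)
    (x : E) : ∃ γ : ℝ → E, γ 0 = x ∧ ∀ s, HasDerivAt γ (F (γ s)) s := by
  have hε : (0 : ℝ) < 1 / (1 + K) := by positivity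
  have hloc : ∀ y : E, ∃ γ : ℝ → E, γ 0 = y ∧
      IsMIntegralCurveOn (I := 𝓘(ℝ, E)) γ F (Set.Ioo (-(1 / (1 + K : ℝ))) (1 / (1 + K))) := by
    intro y
    have hmem : (0 : ℝ) ∈ Set.Icc (-(1 / (1 + K : ℝ))) (1 / (1 + K)) :=
      ⟨by linarith, hε.le⟩
    -- On the ball of radius `‖F y‖` the speed is at most `(1 + K)‖F y‖`, so the existence time
    -- `1/(1 + K)` does not depend on `y`. This uniformity is what allows extension to all times.
    have hpl : IsPicardLindelof (fun _ => F) (tmin := -(1 / (1 + K : ℝ)))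
        (tmax := 1 / (1 + K)) ⟨0, hmem⟩ y ‖F y‖₊ 0 (‖F y‖₊ + K * ‖F y‖₊) K := by
      refine IsPicardLindelof.of_time_independent (fun z hz => ?_) hK.lipschitzOnWith ?_
      · have h1 := hK.dist_le_mul z y
        have h2 := mul_le_mul_of_nonneg_left (Metric.mem_closedBall.1 hz) K.2
        rw [dist_eq_norm] at h1
        have h3 := norm_le_norm_add_norm_sub (F y) (F z)
        rw [norm_sub_rev] at h3
        simp only [NNReal.coe_add, NNReal.coe_mul, coe_nnnorm, NNReal.val_eq_coe] at h2 ⊢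
        linarith
      · simp only [sub_zero, zero_sub, neg_neg, max_self, NNReal.coe_add, NNReal.coe_mul,
          coe_nnnorm, NNReal.coe_zero]
        rw [mul_one_div, div_le_iff₀ (by positivity)]
        linarith
    obtain ⟨γ, h0, hγ⟩ := hpl.exists_eq_forall_mem_Icc_hasDerivWithinAt₀
    refine ⟨γ, h0, fun s hs => ?_⟩
    have h := (hγ s (Set.Ioo_subset_Icc_self hs)).hasDerivAt (Icc_mem_nhds hs.1 hs.2)
    exact h.hasFDerivAt.hasMFDerivAt.hasMFDerivWithinAt
  obtain ⟨γ, h0, hγ⟩ := exists_isMIntegralCurve_of_isMIntegralCurveOn (I := 𝓘(ℝ, E)) (v := F)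
    (contMDiff_vectorSpace_iff_contDiff.2 hF) hε hloc x
  refine ⟨γ, h0, fun s => ?_⟩
  have h : HasFDerivAt γ ((1 : ℝ →L[ℝ] ℝ).smulRight (F (γ s))) s := (hγ s).hasFDerivAt
  exact h.hasDerivAt.congr_deriv (by simp)

section Flow

variable {d : ℕ} {m M : ℝ} {H : ℝ × Space d × Space d → ℝ}

/-- The Hamiltonian vector field. -/
noncomputable def hamField (H : ℝ × Space d × Space d → ℝ) (s : ℝ) (x : Space d × Space d) :
    Space d × Space d :=
  (gradP H (s, x), -gradQ H (s, x))

theorem isOrbit_iff {γ : ℝ → Space d × Space d} :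
    IsOrbit H γ ↔ ∀ s, HasDerivAt γ (hamField H s (γ s)) s := by
  refine forall_congr' fun s => ⟨fun h => h.1.prodMk h.2, fun h => ⟨?_, ?_⟩⟩
  · exact (hasFDerivAt_fst (𝕜 := ℝ) (p := γ s)).comp_hasDerivAt s h
  · exact (hasFDerivAt_snd (𝕜 := ℝ) (p := γ s)).comp_hasDerivAt s h

theorem IsOrbit.continuous {γ : ℝ → Space d × Space d} (h : IsOrbit H γ) : Continuous γ :=
  continuous_iff_continuousAt.2 fun s => (isOrbit_iff.1 h s).continuousAt

theorem euclNorm_le (v : ℝ × Space d × Space d) : euclNorm v ≤ 2 * ‖v‖ := by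
  have h1 : |v.1| ≤ ‖v‖ := norm_fst_le v
  have h2 : ‖v.2.1‖ ≤ ‖v‖ := (norm_fst_le v.2).trans (norm_snd_le v)
  have h3 : ‖v.2.2‖ ≤ ‖v‖ := (norm_snd_le v.2).trans (norm_snd_le v)
  refine Real.sqrt_le_iff.2 ⟨by positivity, ?_⟩
  rw [← sq_abs v.1]
  nlinarith [pow_le_pow_left₀ (abs_nonneg _) h1 2, pow_le_pow_left₀ (norm_nonneg _) h2 2,
    pow_le_pow_left₀ (norm_nonneg _) h3 2, sq_nonneg ‖v‖]

theorem euclNorm_zero_le (x : Space d × Space d) : euclNorm ((0 : ℝ), x) ≤ 3 / 2 * ‖x‖ := by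
  refine Real.sqrt_le_iff.2 ⟨by positivity, ?_⟩
  nlinarith [pow_le_pow_left₀ (norm_nonneg _) (norm_fst_le x) 2,
    pow_le_pow_left₀ (norm_nonneg _) (norm_snd_le x) 2, sq_nonneg ‖x‖]

namespace IsUniformlyConvexHamiltonian

variable (hH : IsUniformlyConvexHamiltonian m M H) (hM : 0 < M)

include hH hM

theorem norm_hamField_sub_le (s : ℝ) (x y : Space d × Space d) :
    ‖hamField H s x - hamField H s y‖ ≤ 3 / 2 * M * ‖x - y‖ := by
  have e : ((s, y) : ℝ × Space d × Space d) + (0, x - y) = (s, x) := by simp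
  have h1 := hH.norm_gradP_sub_le hM (s, y) (0, x - y)
  have h2 := hH.norm_gradQ_sub_le hM (s, y) (0, x - y)
  rw [e] at h1 h2
  have h3 := mul_le_mul_of_nonneg_left (euclNorm_zero_le (x - y)) hM.le
  refine norm_prod_le_iff.2 ⟨?_, ?_⟩
  · simp only [hamField, Prod.fst_sub]
    linarith
  · simp only [hamField, Prod.snd_sub, neg_sub_neg]
    rw [norm_sub_rev]
    linarith

theorem lipschitzWith_hamField (s : ℝ) :
    LipschitzWith (Real.toNNReal (3 / 2 * M)) (hamField H s) :=
  LipschitzWith.of_dist_le_mul fun x y => by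
    rw [dist_eq_norm, dist_eq_norm, Real.coe_toNNReal _ (by positivity)]
    exact hH.norm_hamField_sub_le hM s x y

theorem orbit_ext {γ η : ℝ → Space d × Space d} (hγ : IsOrbit H γ) (hη : IsOrbit H η) {s : ℝ}
    (h : γ s = η s) : γ = η :=
  ODE_solution_unique_univ (v := hamField H) (s := fun _ => Set.univ)
    (fun s => (hH.lipschitzWith_hamField hM s).lipschitzOnWith)
    (fun s => ⟨isOrbit_iff.1 hγ s, trivial⟩) (fun s => ⟨isOrbit_iff.1 hη s, trivial⟩) h

theorem exists_orbit (τ : ℝ) (x : Space d × Space d) : ∃ γ, IsOrbit H γ ∧ γ τ = x := by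
  -- Time becomes a coordinate of unit speed, so that the field is autonomous. It is globally
  -- Lipschitz because the bound on `d²H` includes the `t` direction.
  let F : ℝ × Space d × Space d → ℝ × Space d × Space d := fun z => (1, gradP H z, -gradQ H z)
  have hF : ContDiff ℝ 1 F :=
    contDiff_const.prodMk ((contDiff_gradP hH.contDiff).prodMk (contDiff_gradQ hH.contDiff).neg)
  have hL : LipschitzWith (Real.toNNReal (2 * M)) F := by
    refine LipschitzWith.of_dist_le_mul fun z w => ?_
    rw [dist_eq_norm, dist_eq_norm, Real.coe_toNNReal _ (by positivity)]
    have h1 := hH.norm_gradP_sub_le hM w (z - w)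
    have h2 := hH.norm_gradQ_sub_le hM w (z - w)
    have h3 := mul_le_mul_of_nonneg_left (euclNorm_le (z - w)) hM.le
    rw [add_sub_cancel] at h1 h2
    refine norm_prod_le_iff.2 ⟨?_, norm_prod_le_iff.2 ⟨?_, ?_⟩⟩
    · simp only [F, Prod.fst_sub, sub_self, norm_zero]
      positivity
    · simp only [F, Prod.fst_sub, Prod.snd_sub]
      linarith
    · simp only [F, Prod.snd_sub, neg_sub_neg]
      rw [norm_sub_rev]
      linarith
  obtain ⟨γ, h0, hγ⟩ := exists_global_solution hF hL (τ, x)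
  have hfst : ∀ s, (γ s).1 = τ + s := by
    have hd : ∀ s, HasDerivAt (fun s => (γ s).1 - s) 0 s := fun s => by
      have := ((hasFDerivAt_fst (𝕜 := ℝ) (p := γ s)).comp_hasDerivAt s (hγ s)).sub
        (hasDerivAt_id s)
      exact this.congr_deriv (by simp [F])
    intro s
    have := is_const_of_deriv_eq_zero (fun s => (hd s).differentiableAt)
      (fun s => (hd s).deriv) s 0
    simp only [h0, sub_zero] at this
    linarith
  refine ⟨fun s => (γ (s - τ)).2, isOrbit_iff.2 fun s => ?_, by simp [h0]⟩
  have h1 := (hasFDerivAt_snd (𝕜 := ℝ) (p := γ (s - τ))).comp_hasDerivAt s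
    ((hγ (s - τ)).comp_sub_const s τ)
  refine h1.congr_deriv ?_
  have e : γ (s - τ) = (s, (γ (s - τ)).2) := Prod.ext (by rw [hfst]; ring) rfl
  simp only [F, hamField, ContinuousLinearMap.coe_snd']
  rw [← e]

theorem flow_spec (τ : ℝ) (x : Space d × Space d) :
    ∃ γ, IsOrbit H γ ∧ γ τ = x ∧ ∀ t, flow H τ t x = γ t := by
  have h := Classical.epsilon_spec (hH.exists_orbit hM τ x)
  exact ⟨_, h.1, h.2, fun t => rfl⟩

theorem flow_eq {γ : ℝ → Space d × Space d} (hγ : IsOrbit H γ) (τ t : ℝ) :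
    flow H τ t (γ τ) = γ t := by
  obtain ⟨η, hη, h1, h2⟩ := hH.flow_spec hM τ (γ τ)
  rw [h2, hH.orbit_ext hM hη hγ h1]

theorem norm_orbit_sub_le {γ η : ℝ → Space d × Space d} (hγ : IsOrbit H γ) (hη : IsOrbit H η)
    {a b : ℝ} (hab : a ≤ b) :
    ‖γ b - η b‖ ≤ ‖γ a - η a‖ * Real.exp (3 / 2 * M * (b - a)) := by
  have h := dist_le_of_trajectories_ODE (v := hamField H) (fun s => hH.lipschitzWith_hamField hM s)
    hγ.continuous.continuousOn (fun s _ => (isOrbit_iff.1 hγ s).hasDerivWithinAt)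
    hη.continuous.continuousOn (fun s _ => (isOrbit_iff.1 hη s).hasDerivWithinAt)
    (le_refl (dist (γ a) (η a))) b ⟨hab, le_rfl⟩
  rwa [dist_eq_norm, dist_eq_norm, Real.coe_toNNReal _ (by positivity)] at h

theorem norm_orbit_sub_sub_le {γ η : ℝ → Space d × Space d} (hγ : IsOrbit H γ)
    (hη : IsOrbit H η) {a b : ℝ} (hab : a ≤ b) :
    ‖(γ b - η b) - (γ a - η a)‖ ≤
      3 / 2 * M * (b - a) * Real.exp (3 / 2 * M * (b - a)) * ‖γ a - η a‖ := by
  have hd : ∀ s, HasDerivAt (fun s => γ s - η s) (hamField H s (γ s) - hamField H s (η s)) s :=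
    fun s => (isOrbit_iff.1 hγ s).sub (isOrbit_iff.1 hη s)
  have h := norm_image_sub_le_of_norm_deriv_le_segment'
    (f := fun s => γ s - η s) (C := 3 / 2 * M * (‖γ a - η a‖ * Real.exp (3 / 2 * M * (b - a))))
    (fun s _ => (hd s).hasDerivWithinAt) (fun s hs => by
      refine (hH.norm_hamField_sub_le hM s _ _).trans ?_
      refine mul_le_mul_of_nonneg_left ((hH.norm_orbit_sub_le hM hγ hη hs.1).trans ?_)
        (by positivity)
      have := hs.2.le
      gcongr) b ⟨hab, le_rfl⟩
  refine h.trans (le_of_eq ?_)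
  ring

end IsUniformlyConvexHamiltonian

end Flow

/-! ### Twist property and generating functions on short intervals -/

section Twist

variable {d : ℕ} {m M : ℝ} {H : ℝ × Space d × Space d → ℝ}

namespace IsUniformlyConvexHamiltonian

variable (hH : IsUniformlyConvexHamiltonian m M H) (hM : 0 < M)

include hH

/-- Both bounds are tested on a vertical vector `(0, 0, y)`. Without a nonzero `y` nothing compares
`m` and `M`, so dimension zero is treated separately below. -/
theorem le_of_nontrivial [Nontrivial (Space d)] : m ≤ M := by
  obtain ⟨y, hy⟩ := exists_ne (0 : Space d)
  have h := (hH.convex_momentum 0 y).trans ((le_abs_self _).trans (hH.secondDiff_le 0 _ _))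
  have e : euclNorm ((0 : ℝ), (0 : Space d), y) = ‖y‖ := by simp [euclNorm]
  rw [e, ← pow_two] at h
  exact le_of_mul_le_mul_right h (by positivity)

include hM

/-- Twist property: on short time intervals, the final position depends in a strongly monotone way
on the initial momentum. -/
theorem twist (hmM : m ≤ M) {γ η : ℝ → Space d × Space d} (hγ : IsOrbit H γ) (hη : IsOrbit H η)
    {a b : ℝ} (hab : a ≤ b) (hσ : b - a < twistTime m M) (h0 : (γ a).1 = (η a).1) :
    (b - a) * (m / 2) * ‖(γ a).2 - (η a).2‖ ^ 2 ≤
      ⟪(γ b).1 - (η b).1, (γ a).2 - (η a).2⟫_ℝ := by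
  have hm := hH.m_pos
  set P : Space d := (γ a).2 - (η a).2 with hP
  have hx : γ a - η a = (0, P) := Prod.ext (by simp [h0]) rfl
  have hnx : ‖γ a - η a‖ = ‖P‖ := by rw [hx]; simp [Prod.norm_def]
  have hΛ : 3 / 2 * M * (b - a) ≤ 3 / 128 * (m / M) := by
    have h1 : b - a ≤ m ^ 2 / (64 * M ^ 3) := hσ.le
    calc 3 / 2 * M * (b - a) ≤ 3 / 2 * M * (m ^ 2 / (64 * M ^ 3)) := by gcongr
      _ = 3 / 128 * (m / M * (m / M)) := by field_simp; norm_num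
      _ ≤ 3 / 128 * (m / M * 1) := by
        gcongr
        exact (div_le_one hM).2 hmM
      _ = _ := by ring
  have hmM' : m / M ≤ 1 := (div_le_one hM).2 hmM
  have hexp : Real.exp (3 / 2 * M * (b - a)) ≤ 2 := by
    have h1 : Real.exp (3 / 2 * M * (b - a)) ≤ Real.exp (Real.log 2) := by
      rw [Real.exp_le_exp]
      have := Real.log_two_gt_d9
      linarith
    rwa [Real.exp_log two_pos] at h1
  -- The difference of the orbits stays close to its initial value `(0, P)`. Replacing it by `(0,
  -- P)` in the velocity costs `9/128 m ‖P‖`, which leaves at least `m/2` of the monotonicity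
  -- constant `m`.
  have hdiff : ∀ s ∈ Set.Icc a b, ‖(γ s - η s) - (0, P)‖ ≤ 3 / 64 * (m / M) * ‖P‖ := by
    intro s hs
    have h := hH.norm_orbit_sub_sub_le hM hγ hη hs.1
    rw [hnx, hx] at h
    refine h.trans ?_
    have h1 : s - a ≤ b - a := by linarith [hs.2]
    have h0 : 0 ≤ s - a := by linarith [hs.1]
    have h2 : 3 / 2 * M * (s - a) ≤ 3 / 2 * M * (b - a) := by gcongr
    calc 3 / 2 * M * (s - a) * Real.exp (3 / 2 * M * (s - a)) * ‖P‖
        ≤ 3 / 128 * (m / M) * 2 * ‖P‖ :=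
          mul_le_mul_of_nonneg_right (mul_le_mul (h2.trans hΛ)
            ((Real.exp_le_exp.2 h2).trans hexp) (Real.exp_pos _).le (by positivity))
            (norm_nonneg _)
      _ = _ := by ring
  have hd : ∀ s, HasDerivAt (fun s => ⟪(γ s).1 - (η s).1, P⟫_ℝ)
      ⟪gradP H (s, γ s) - gradP H (s, η s), P⟫_ℝ s := fun s =>
    (((hγ s).1.sub (hη s).1).inner ℝ (hasDerivAt_const s P)).congr_deriv (by
      simp only [inner_zero_right, zero_add]; rfl)
  have hle : ∀ s ∈ Set.Icc a b, m / 2 * ‖P‖ ^ 2 ≤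
      ⟪gradP H (s, γ s) - gradP H (s, η s), P⟫_ℝ := by
    intro s hs
    have h1 := hH.strongly_monotone_gradP s (η s).1 (η s).2 P
    have h2 := hH.norm_gradP_sub_le hM (s, (η s).1, (η s).2 + P) (0, (γ s - η s) - (0, P))
    have e : ((s, (η s).1, (η s).2 + P) : ℝ × Space d × Space d) + (0, (γ s - η s) - (0, P)) =
        (s, γ s) := by
      refine Prod.ext (by simp) (Prod.ext (by simp) ?_)
      simp
    rw [e] at h2
    have h3 := mul_le_mul_of_nonneg_left ((euclNorm_zero_le _).trans
      (mul_le_mul_of_nonneg_left (hdiff s hs) (by norm_num : (0 : ℝ) ≤ 3 / 2))) hM.le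
    have h4 : M * (3 / 2 * (3 / 64 * (m / M) * ‖P‖)) = 9 / 128 * m * ‖P‖ := by
      field_simp
      ring
    rw [h4] at h3
    have h5 := (abs_le.1 (abs_real_inner_le_norm
      (gradP H (s, γ s) - gradP H (s, (η s).1, (η s).2 + P)) P)).1
    have h6 := mul_le_mul_of_nonneg_right (h2.trans h3) (norm_nonneg P)
    have h7 : ⟪gradP H (s, γ s) - gradP H (s, η s), P⟫_ℝ =
        ⟪gradP H (s, γ s) - gradP H (s, (η s).1, (η s).2 + P), P⟫_ℝ +
        ⟪gradP H (s, (η s).1, (η s).2 + P) - gradP H (s, (η s).1, (η s).2), P⟫_ℝ := by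
      rw [← inner_add_left]
      congr 1
      abel
    rw [h7]
    nlinarith [sq_nonneg ‖P‖]
  have := (convex_Icc a b).mul_sub_le_image_sub_of_le_deriv
    (fun s _ => (hd s).continuousAt.continuousWithinAt)
    (fun s _ => (hd s).differentiableAt.differentiableWithinAt)
    (fun s hs => by rw [(hd s).deriv]; exact hle s (interior_subset hs))
    a ⟨le_rfl, hab⟩ b ⟨hab, le_rfl⟩ hab
  simp only [h0, sub_self, inner_zero_left, sub_zero] at this
  linarith

theorem orbit_unique_of_endpoints {γ η : ℝ → Space d × Space d} (hγ : IsOrbit H γ)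
    (hη : IsOrbit H η) {a b : ℝ} (hab : a < b) (hσ : b - a < twistTime m M)
    (h0 : (γ a).1 = (η a).1) (h1 : (γ b).1 = (η b).1) : γ = η := by
  refine hH.orbit_ext hM hγ hη (s := a) (Prod.ext h0 ?_)
  rcases subsingleton_or_nontrivial (Space d) with _ | _
  · exact Subsingleton.elim _ _
  · have h := hH.twist hM hH.le_of_nontrivial hγ hη hab.le hσ h0
    rw [h1, sub_self, inner_zero_left] at h
    have hpos : 0 < (b - a) * (m / 2) := mul_pos (sub_pos.2 hab) (half_pos hH.m_pos)
    have h2 : ‖(γ a).2 - (η a).2‖ ^ 2 ≤ 0 := nonpos_of_mul_nonpos_right h hpos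
    exact sub_eq_zero.1 (norm_eq_zero.1 (pow_eq_zero_iff two_ne_zero |>.1
      (le_antisymm h2 (sq_nonneg _))))

theorem exists_orbit_of_endpoints {a b : ℝ} (hab : a < b) (hσ : b - a < twistTime m M)
    (q₀ q₁ : Space d) : ∃ γ, IsOrbit H γ ∧ (γ a).1 = q₀ ∧ (γ b).1 = q₁ := by
  rcases subsingleton_or_nontrivial (Space d) with _ | _
  · obtain ⟨γ, hγ, -⟩ := hH.exists_orbit hM a (q₀, 0)
    exact ⟨γ, hγ, Subsingleton.elim _ _, Subsingleton.elim _ _⟩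
  · choose γ hγ hγa using fun p : Space d => hH.exists_orbit hM a (q₀, p)
    have hpos : 0 < (b - a) * (m / 2) := mul_pos (sub_pos.2 hab) (half_pos hH.m_pos)
    have hsurj : Function.Surjective fun p => (γ p b).1 := by
      refine surjective_of_strongly_monotone hpos (L := Real.exp (3 / 2 * M * (b - a)))
        (fun p p' => ?_) fun p p' => ?_
      · simpa [hγa] using hH.twist hM hH.le_of_nontrivial (hγ p) (hγ p') hab.le hσ (by simp [hγa])
      · have h := hH.norm_orbit_sub_le hM (hγ p) (hγ p') hab.le
        refine (norm_fst_le (γ p b - γ p' b)).trans (h.trans (le_of_eq ?_))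
        rw [hγa, hγa]
        simp [Prod.norm_def, mul_comm]
    obtain ⟨p, hp⟩ := hsurj q₁
    exact ⟨γ p, hγ p, by simp [hγa], hp⟩

theorem generatingFunction_spec {a b : ℝ} (hab : a < b) (hσ : b - a < twistTime m M)
    (q₀ q₁ : Space d) : ∃ γ, IsOrbit H γ ∧ (γ a).1 = q₀ ∧ (γ b).1 = q₁ ∧
      generatingFunction H a b q₀ q₁ = action H a b γ := by
  have h := Classical.epsilon_spec (hH.exists_orbit_of_endpoints hM hab hσ q₀ q₁)
  exact ⟨_, h.1, h.2.1, h.2.2, rfl⟩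

/-- By uniqueness, the orbit selected by `Classical.epsilon` is the given one. -/
theorem generatingFunction_orbit {a b : ℝ} (hab : a < b) (hσ : b - a < twistTime m M)
    {γ : ℝ → Space d × Space d} (hγ : IsOrbit H γ) :
    generatingFunction H a b (γ a).1 (γ b).1 = action H a b γ := by
  obtain ⟨η, hη, h0, h1, h2⟩ := hH.generatingFunction_spec hM hab hσ (γ a).1 (γ b).1
  rw [h2, hH.orbit_unique_of_endpoints hM hη hγ hab hσ h0 h1]

end IsUniformlyConvexHamiltonian

end Twist

/-! ### Calibration and the comparison of actions -/

section Comparison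

variable {d : ℕ} {m M : ℝ} {H : ℝ × Space d × Space d → ℝ}

theorem IsOrbit.action_eq {γ : ℝ → Space d × Space d} (hγ : IsOrbit H γ) (a b : ℝ) :
    action H a b γ = ∫ s in a..b, (⟪(γ s).2, gradP H (s, γ s)⟫_ℝ - H (s, γ s)) := by
  refine intervalIntegral.integral_congr fun s _ => ?_
  simp only [(hγ s).1.deriv]
  rfl

theorem IsOrbit.continuous_lagrangian (h : ContDiff ℝ 2 H) {γ : ℝ → Space d × Space d}
    (hγ : IsOrbit H γ) : Continuous fun s => ⟪(γ s).2, gradP H (s, γ s)⟫_ℝ - H (s, γ s) := by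
  have h1 := hγ.continuous
  have h2 := h.continuous
  have h3 := (contDiff_gradP h).continuous
  fun_prop

/-- The function whose variation along an orbit `x` bounds from below the difference of the actions
of a curve through `q` and of `x`. -/
noncomputable def calibration (k : ℝ → ℝ) (x : ℝ → Space d × Space d) (s : ℝ) (q : Space d) : ℝ :=
  ⟪(x s).2, q - (x s).1⟫_ℝ - k s * ‖q - (x s).1‖ ^ 2

@[simp]
theorem calibration_self (k : ℝ → ℝ) (x : ℝ → Space d × Space d) (s : ℝ) :
    calibration k x s (x s).1 = 0 := by
  simp [calibration]

namespace IsUniformlyConvexHamiltonian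

variable (hH : IsUniformlyConvexHamiltonian m M H) (hM : 0 < M)

include hH hM

/-- The integrated form of `lagrangian_gap`: its right-hand side, with `κ = k'`, is the difference
of the Lagrangians minus the derivative of the calibration along `γ`. The remainder weighted by `c`
later yields strong monotonicity. -/
theorem action_sub_action_ge {x γ : ℝ → Space d × Space d} (hx : IsOrbit H x)
    (hγ : IsOrbit H γ) {a b : ℝ} (hab : a ≤ b) {k : ℝ → ℝ} {r c : ℝ}
    (hk : ∀ s, HasDerivAt k r s) (hk0 : ∀ s ∈ Set.Icc a b, 0 ≤ k s) (hc0 : 0 ≤ c)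
    (hcm : c ≤ m / 4)
    (hcr : ∀ s ∈ Set.Icc a b, c ≤ r - M / 2 - 2 * k s * M - 4 * k s ^ 2 * M) :
    calibration k x b (γ b).1 - calibration k x a (γ a).1
        + c * ∫ s in a..b, ‖γ s - x s‖ ^ 2 ≤
      action H a b γ - action H a b x := by
  have hLγ := hγ.continuous_lagrangian hH.contDiff
  have hLx := hx.continuous_lagrangian hH.contDiff
  have hcd : Continuous fun s => c * ‖γ s - x s‖ ^ 2 :=
    continuous_const.mul ((hγ.continuous.sub hx.continuous).norm.pow 2)
  have hd : ∀ s, HasDerivAt (fun s => calibration k x s (γ s).1)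
      (⟪(x s).2, gradP H (s, γ s) - gradP H (s, x s)⟫_ℝ
        + ⟪-gradQ H (s, x s), (γ s).1 - (x s).1⟫_ℝ
        - (r * ‖(γ s).1 - (x s).1‖ ^ 2 + k s *
          (2 * ⟪(γ s).1 - (x s).1, gradP H (s, γ s) - gradP H (s, x s)⟫_ℝ))) s := fun s => by
    have h1 := (hγ s).1.sub (hx s).1
    exact ((hx s).2.inner ℝ h1).sub ((hk s).mul h1.norm_sq)
  have hcont : ContinuousOn (fun s => calibration k x s (γ s).1) (Set.Icc a b) :=
    fun s _ => (hd s).continuousAt.continuousWithinAt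
  have key := intervalIntegral.sub_le_integral_of_hasDeriv_right_of_le hab hcont
    (fun s _ => (hd s).hasDerivWithinAt)
    (((hLγ.sub hLx).sub hcd).continuousOn.integrableOn_compact isCompact_Icc) (fun s hs => by
      have hs' := Set.Ioo_subset_Icc_self hs
      have h1 := hH.lagrangian_gap hM (hk0 s hs') r s (x s).1 (x s).2 (γ s).1 (γ s).2
      have h2 : ‖γ s - x s‖ ^ 2 ≤ ‖(γ s).1 - (x s).1‖ ^ 2 + ‖(γ s).2 - (x s).2‖ ^ 2 := by
        rw [Prod.norm_def]
        rcases max_choice ‖(γ s - x s).1‖ ‖(γ s - x s).2‖ with h | h <;> rw [h]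
        · exact le_add_of_nonneg_right (sq_nonneg _)
        · exact le_add_of_nonneg_left (sq_nonneg _)
      have h3 := mul_le_mul_of_nonneg_left h2 hc0
      have h4 := mul_le_mul_of_nonneg_right hcm (sq_nonneg ‖(γ s).2 - (x s).2‖)
      have h5 := mul_le_mul_of_nonneg_right (hcr s hs') (sq_nonneg ‖(γ s).1 - (x s).1‖)
      have h6 : ⟪(γ s).2 - (x s).2, gradP H (s, γ s)⟫_ℝ = ⟪(γ s).2, gradP H (s, γ s)⟫_ℝ
          - ⟪(x s).2, gradP H (s, γ s)⟫_ℝ := inner_sub_left _ _ _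
      simp only [Prod.mk.eta] at h1
      rw [inner_neg_left, inner_sub_right]
      simp only [Pi.sub_apply]
      linarith)
  have hint : (∫ s in a..b, (((⟪(γ s).2, gradP H (s, γ s)⟫_ℝ - H (s, γ s))
      - (⟪(x s).2, gradP H (s, x s)⟫_ℝ - H (s, x s))) - c * ‖γ s - x s‖ ^ 2)) =
      action H a b γ - action H a b x - c * ∫ s in a..b, ‖γ s - x s‖ ^ 2 := by
    have hLd : Continuous fun s => (⟪(γ s).2, gradP H (s, γ s)⟫_ℝ - H (s, γ s))
        - (⟪(x s).2, gradP H (s, x s)⟫_ℝ - H (s, x s)) := hLγ.sub hLx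
    rw [intervalIntegral.integral_sub (hLd.intervalIntegrable _ _)
      (hcd.intervalIntegrable _ _),
      intervalIntegral.integral_sub (hLγ.intervalIntegrable _ _) (hLx.intervalIntegrable _ _),
      hγ.action_eq, hx.action_eq, intervalIntegral.integral_const_mul]
  have key' := key.trans_eq hint
  linarith

variable {t : ℝ} (ht : 0 < t) {n : ℕ} (hn : 1 ≤ n) (hnt : t / n < twistTime m M)
  {k : ℝ → ℝ} {r : ℝ} (hk : ∀ s, HasDerivAt k r s) (hk0 : ∀ s ∈ Set.Icc 0 t, 0 ≤ k s)
  (hkr : ∀ s ∈ Set.Icc 0 t, 0 ≤ r - M / 2 - 2 * k s * M - 4 * k s ^ 2 * M)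

include ht hn hnt

theorem sum_generatingFunction_orbit {x : ℝ → Space d × Space d} (hx : IsOrbit H x) :
    ∑ i ∈ Finset.range n, generatingFunction H (0 + i * ((t - 0) / n))
      (0 + (i + 1) * ((t - 0) / n)) (x (0 + i * ((t - 0) / n))).1
      (x (0 + (i + 1) * ((t - 0) / n))).1 = action H 0 t x := by
  have hn0 : (0 : ℝ) < n := by exact_mod_cast hn
  have hstep : 0 < t / n := div_pos ht hn0
  have h1 : ∀ i : ℕ, generatingFunction H (0 + i * ((t - 0) / n))
      (0 + (i + 1) * ((t - 0) / n)) (x (0 + i * ((t - 0) / n))).1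
      (x (0 + (i + 1) * ((t - 0) / n))).1 =
      ∫ s in (i * (t / n))..((i + 1 : ℕ) * (t / n)),
        (⟪(x s).2, gradP H (s, x s)⟫_ℝ - H (s, x s)) := fun i => by
    simp only [sub_zero, zero_add]
    rw [hH.generatingFunction_orbit hM (by linarith) (by linarith) hx, hx.action_eq]
    push_cast
    rfl
  rw [Finset.sum_congr rfl fun i _ => h1 i, hx.action_eq,
    intervalIntegral.sum_integral_adjacent_intervals (a := fun i : ℕ => (i : ℝ) * (t / n))
      fun i _ => (hx.continuous_lagrangian hH.contDiff).intervalIntegrable _ _]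
  congr 1
  · simp
  · field_simp

include hk hk0 hkr

/-- The comparison holds on each piece of the broken orbit, and the calibration telescopes because
it depends only on the position at the break points, not on the momentum, which may jump there. -/
theorem sum_generatingFunction_ge {x : ℝ → Space d × Space d} (hx : IsOrbit H x)
    (θ : ℕ → Space d) :
    action H 0 t x + calibration k x t (θ n) - calibration k x 0 (θ 0) ≤
      ∑ i ∈ Finset.range n, generatingFunction H (0 + i * ((t - 0) / n))
        (0 + (i + 1) * ((t - 0) / n)) (θ i) (θ (i + 1)) := by
  have hn0 : (0 : ℝ) < n := by exact_mod_cast hn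
  have hstep : 0 < t / n := div_pos ht hn0
  have hi : ∀ i ∈ Finset.range n,
      generatingFunction H (0 + i * ((t - 0) / n)) (0 + (i + 1) * ((t - 0) / n))
        (x (0 + i * ((t - 0) / n))).1 (x (0 + (i + 1) * ((t - 0) / n))).1
      + (calibration k x ((i + 1 : ℕ) * (t / n)) (θ (i + 1))
        - calibration k x (i * (t / n)) (θ i)) ≤
      generatingFunction H (0 + i * ((t - 0) / n)) (0 + (i + 1) * ((t - 0) / n))
        (θ i) (θ (i + 1)) := by
    intro i hi
    have hin : ((i + 1 : ℕ) : ℝ) ≤ n := by exact_mod_cast Finset.mem_range.1 hi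
    push_cast at hin ⊢
    simp only [sub_zero, zero_add]
    have hlt : i * (t / n) < (i + 1) * (t / n) := by linarith
    have hσ : (i + 1) * (t / n) - i * (t / n) < twistTime m M := by linarith
    obtain ⟨γ, hγ, h0, h1, h2⟩ := hH.generatingFunction_spec hM hlt hσ (θ i) (θ (i + 1))
    rw [h2, hH.generatingFunction_orbit hM hlt hσ hx]
    have hsub : Set.Icc (i * (t / n)) ((i + 1) * (t / n)) ⊆ Set.Icc 0 t := by
      refine Set.Icc_subset_Icc (by positivity) ?_
      calc (i + 1) * (t / n) ≤ n * (t / n) := by gcongr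
        _ = t := by field_simp
    have h := hH.action_sub_action_ge hM hx hγ hlt.le hk (fun s hs => hk0 s (hsub hs)) le_rfl
      (by linarith [hH.m_pos]) fun s hs => hkr s (hsub hs)
    rw [h0, h1] at h
    linarith
  have hsum := Finset.sum_le_sum hi
  rw [Finset.sum_add_distrib, hH.sum_generatingFunction_orbit hM ht hn hnt hx,
    Finset.sum_range_sub fun i : ℕ => calibration k x (i * (t / n)) (θ i)] at hsum
  have e : (n : ℝ) * (t / n) = t := by field_simp
  rw [e, Nat.cast_zero, zero_mul] at hsum
  linarith

theorem minimalAction_ge {x : ℝ → Space d × Space d} (hx : IsOrbit H x) (q₀ q₁ : Space d) :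
    action H 0 t x + calibration k x t q₁ - calibration k x 0 q₀ ≤
      minimalAction H n 0 t q₀ q₁ := by
  have : Nonempty {θ : ℕ → Space d // θ 0 = q₀ ∧ θ n = q₁} :=
    ⟨⟨fun i => if i = 0 then q₀ else q₁, by simp, by simp [show n ≠ 0 by omega]⟩⟩
  refine le_ciInf fun θ => ?_
  have h := hH.sum_generatingFunction_ge hM ht hn hnt hk hk0 hkr hx θ.1
  rwa [θ.2.1, θ.2.2] at h

/-- Every orbit is minimizing up to time `t`, although `t` may exceed the twist time: sampling the
orbit gives a competitor, and the calibration, which vanishes along `x`, gives the opposite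
inequality. It also bounds the sums from below, so that the real infimum is genuine. -/
theorem minimalAction_orbit {x : ℝ → Space d × Space d} (hx : IsOrbit H x) :
    minimalAction H n 0 t (x 0).1 (x t).1 = action H 0 t x := by
  have hn0 : (0 : ℝ) < n := by exact_mod_cast hn
  refine le_antisymm ?_ ?_
  · rw [← hH.sum_generatingFunction_orbit hM ht hn hnt hx]
    refine (ciInf_le ?_ ⟨fun i => (x (0 + i * ((t - 0) / n))).1, by simp, ?_⟩).trans_eq ?_
    · refine ⟨action H 0 t x + calibration k x t (x t).1 - calibration k x 0 (x 0).1, ?_⟩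
      rintro _ ⟨θ, rfl⟩
      have h := hH.sum_generatingFunction_ge hM ht hn hnt hk hk0 hkr hx θ.1
      rwa [θ.2.1, θ.2.2] at h
    · refine Finset.sum_congr rfl fun i _ => ?_
      push_cast
      rfl
    · have e : 0 + n * ((t - 0) / n) = t := by field_simp; ring
      simp only [e]
  · simpa using hH.minimalAction_ge hM ht hn hnt hk hk0 hkr hx (x 0).1 (x t).1

end IsUniformlyConvexHamiltonian

end Comparison

/-! ### Sub-differential graph of a semi-convex function and its Minty parametrization -/

section SemiConvex

variable {d : ℕ} {K : ℝ} {u : Space d → ℝ}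

/-- The graph of the sub-differential of a `K`-semi-convex function, described by paraboloids. -/
noncomputable def paraboloidGraph (K : ℝ) (u : Space d → ℝ) : Set (Space d × Space d) :=
  {x | ∀ y, u x.1 + ⟪x.2, y - x.1⟫_ℝ - K * ‖y - x.1‖ ^ 2 ≤ u y}

theorem norm_sq_eq_add (x y : Space d) :
    ‖y‖ ^ 2 = ‖x‖ ^ 2 + 2 * ⟪x, y - x⟫_ℝ + ‖y - x‖ ^ 2 := by
  rw [norm_sub_sq_real, inner_sub_right, real_inner_self_eq_norm_sq, real_inner_comm]
  ring

theorem mem_paraboloidGraph_iff {q p : Space d} :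
    (q, p) ∈ paraboloidGraph K u ↔
      ∀ y, u q + K * ‖q‖ ^ 2 + ⟪p + (2 * K) • q, y - q⟫_ℝ ≤ u y + K * ‖y‖ ^ 2 := by
  refine forall_congr' fun y => ?_
  rw [norm_sq_eq_add q y, inner_add_left, real_inner_smul_left]
  simp only
  constructor <;> intro h <;> linarith

/-- A `C¹` test function is only local information, but after adding `K‖·‖²` convexity makes its
tangent hyperplane a global lower bound. Conversely the paraboloid is itself a test function. -/
theorem subDifferentialGraph_eq (hu : IsSemiConvex K u) :
    subDifferentialGraph u = paraboloidGraph K u := by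
  ext ⟨q, p⟩
  constructor
  · rintro ⟨v, hv, hvp, hmin⟩
    have hd : HasFDerivAt v (innerSL ℝ p) q := by
      have := ((hv.differentiable (by norm_num)) q).hasGradientAt
      simp only at hvp
      rw [hvp] at this
      exact this.hasFDerivAt
    have hd2 : HasFDerivAt (fun y => v y + K * ‖y‖ ^ 2)
        (innerSL ℝ (p + (2 * K) • q)) q := by
      refine (hd.add (((hasFDerivAt_id q).norm_sq).const_mul K)).congr_fderiv ?_
      ext w
      simp
      ring
    exact mem_paraboloidGraph_iff.2 (ConvexOn.le_of_touching hu hd2 fun y => by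
      have := hmin y
      simp only at this
      linarith)
  · intro h
    refine ⟨fun y => ⟪p, y - q⟫_ℝ - K * ‖y - q‖ ^ 2, ?_, ?_, fun y => ?_⟩
    · have h1 : ContDiff ℝ 1 fun y : Space d => y - q := contDiff_id.sub contDiff_const
      exact (contDiff_const.inner ℝ h1).sub (contDiff_const.mul (h1.norm_sq ℝ))
    · have h1 : HasFDerivAt (fun y => ⟪p, y - q⟫_ℝ - K * ‖y - q‖ ^ 2) (innerSL ℝ p) q := by
        have h2 := (hasFDerivAt_id (𝕜 := ℝ) q).sub_const q
        refine (((innerSL ℝ p).hasFDerivAt.comp q h2).sub (h2.norm_sq.const_mul K)).congr_fderiv ?_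
        ext w
        simp
      exact HasGradientAt.gradient (show HasGradientAt _ p q from h1)
    · have := h y
      simp only [sub_self, inner_zero_right, norm_zero] at this ⊢
      linarith

theorem IsSemiConvex.exists_mem_paraboloidGraph (hu : IsSemiConvex K u) (q : Space d) :
    ∃ p, (q, p) ∈ paraboloidGraph K u := by
  obtain ⟨g, hg⟩ := ConvexOn.exists_subgradient hu q
  refine ⟨g - (2 * K) • q, mem_paraboloidGraph_iff.2 fun y => ?_⟩
  rw [sub_add_cancel]
  exact hg y

/-- The proximal point `q` of `z` for `u + K‖·‖²` satisfies `z - q = p + 2Kq` with `p` a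
sub-differential of `u` at `q`. -/
theorem IsSemiConvex.exists_paraboloidGraph_resolvent (hu : IsSemiConvex K u) (z : Space d) :
    ∃ x ∈ paraboloidGraph K u, (1 + 2 * K) • x.1 + x.2 = z := by
  obtain ⟨q, hq⟩ := ConvexOn.exists_proximal_point hu z
  refine ⟨(q, z - (1 + 2 * K) • q), mem_paraboloidGraph_iff.2 fun y => ?_, by simp⟩
  rw [show z - (1 + 2 * K) • q + (2 * K) • q = z - q by module]
  exact hq y

theorem paraboloidGraph_monotone {x y : Space d × Space d} (hx : x ∈ paraboloidGraph K u)
    (hy : y ∈ paraboloidGraph K u) :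
    0 ≤ ⟪x.2 - y.2, x.1 - y.1⟫_ℝ + 2 * K * ‖x.1 - y.1‖ ^ 2 := by
  have h1 := hx y.1
  have h2 := hy x.1
  rw [norm_sub_rev] at h1
  rw [← neg_sub x.1 y.1, inner_neg_right] at h1
  rw [inner_sub_left]
  linarith

/-- The inverse of the parametrization `x ↦ (1 + 2K) x.1 + x.2` of the graph is Lipschitz. -/
theorem norm_sub_le_of_mem_paraboloidGraph (hK : 0 ≤ K) {x y : Space d × Space d}
    (hx : x ∈ paraboloidGraph K u) (hy : y ∈ paraboloidGraph K u) :
    ‖x - y‖ ≤ (1 + 2 * K) *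
      ‖((1 + 2 * K) • x.1 + x.2) - ((1 + 2 * K) • y.1 + y.2)‖ := by
  have hmono := paraboloidGraph_monotone hx hy
  set a := x.1 - y.1 with ha
  set b := x.2 - y.2 + (2 * K) • a with hb
  -- With a nonnegative inner product, neither `a` nor `b` is longer than `a + b`, the difference of
  -- the parameters.
  have hab : 0 ≤ ⟪a, b⟫_ℝ := by
    rw [hb, inner_add_right, real_inner_smul_right, real_inner_self_eq_norm_sq, real_inner_comm]
    exact hmono
  have hz : ((1 + 2 * K) • x.1 + x.2) - ((1 + 2 * K) • y.1 + y.2) = a + b := by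
    rw [hb, ha]
    module
  rw [hz]
  have hn := norm_add_sq_real a b
  have h1 : ‖a‖ ≤ ‖a + b‖ := le_of_sq_le_sq (by nlinarith [sq_nonneg ‖b‖]) (norm_nonneg _)
  have h2 : ‖b‖ ≤ ‖a + b‖ := le_of_sq_le_sq (by nlinarith [sq_nonneg ‖a‖]) (norm_nonneg _)
  have h3 : x.2 - y.2 = b - (2 * K) • a := by rw [hb]; abel
  have h4 : 0 ≤ K * ‖a + b‖ := by positivity
  refine norm_prod_le_iff.2 ⟨?_, ?_⟩
  · rw [Prod.fst_sub]
    linarith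
  · rw [Prod.snd_sub, h3]
    refine (norm_sub_le _ _).trans ?_
    rw [norm_smul, Real.norm_of_nonneg (by positivity)]
    have := mul_le_mul_of_nonneg_left h1 hK
    linarith

end SemiConvex

theorem le_div_of_mul_sq_le {a b c : ℝ} (hc : 0 < c) (ha : 0 ≤ a) (hb : 0 ≤ b)
    (h : c * a ^ 2 ≤ a * b) : a ≤ b / c := by
  rw [le_div_iff₀ hc]
  rcases ha.eq_or_lt with rfl | ha'
  · simpa using hb
  · refine le_of_mul_le_mul_left ?_ ha'
    linarith

/-! ### Transport of the sub-differential graph by the flow -/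

section Characteristics

variable {d : ℕ} {m M : ℝ} {H : ℝ × Space d × Space d → ℝ}

namespace IsUniformlyConvexHamiltonian

variable (hH : IsUniformlyConvexHamiltonian m M H) (hM : 0 < M)

include hH hM

/-- Strong monotonicity of the graph transported by the flow. -/
theorem exists_strong_monotonicity {K : ℝ} {u : Space d → ℝ} {t : ℝ} (ht : 0 < t) {k : ℝ → ℝ}
    {r c : ℝ} (hk : ∀ s, HasDerivAt k r s) (hkK : k 0 = K)
    (hk0 : ∀ s ∈ Set.Icc 0 t, 0 ≤ k s) (hc : 0 < c) (hcm : c ≤ m / 4)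
    (hcr : ∀ s ∈ Set.Icc 0 t, c ≤ r - M / 2 - 2 * k s * M - 4 * k s ^ 2 * M) :
    ∃ c' > 0, ∀ x y : ℝ → Space d × Space d, IsOrbit H x → IsOrbit H y →
      x 0 ∈ paraboloidGraph K u → y 0 ∈ paraboloidGraph K u →
      c' * ‖x t - y t‖ ^ 2 ≤ ⟪(x t).1 - (y t).1, (x t).2 - (y t).2⟫_ℝ
        + 2 * k t * ‖(x t).1 - (y t).1‖ ^ 2 := by
  set e : ℝ := Real.exp (3 / 2 * M * t) with he
  have hepos : 0 < e := Real.exp_pos _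
  -- Each orbit is compared with the other, and the two inequalities are added so that actions and
  -- values of `u` cancel. Both integral remainders are bounded below by Gronwall: `‖x s - y s‖ ≥ ‖x
  -- t - y t‖ / e`.
  refine ⟨2 * c * (t * (1 / e) ^ 2), by positivity, fun x y hx hy hx0 hy0 => ?_⟩
  have h1 := hH.action_sub_action_ge hM hx hy ht.le hk hk0 hc.le hcm hcr
  have h2 := hH.action_sub_action_ge hM hy hx ht.le hk hk0 hc.le hcm hcr
  have h3 := hx0 (y 0).1
  have h4 := hy0 (x 0).1
  have hint : t * ((1 / e) ^ 2 * ‖x t - y t‖ ^ 2) ≤ ∫ s in 0..t, ‖x s - y s‖ ^ 2 := by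
    have hle := intervalIntegral.integral_mono_on (f := fun _ => (1 / e) ^ 2 * ‖x t - y t‖ ^ 2)
      (g := fun s => ‖x s - y s‖ ^ 2) (μ := MeasureTheory.volume) ht.le intervalIntegrable_const
      (((hx.continuous.sub hy.continuous).norm.pow 2).intervalIntegrable _ _) fun s hs => by
        have h5 := hH.norm_orbit_sub_le hM hx hy hs.2
        have h6 : Real.exp (3 / 2 * M * (t - s)) ≤ e := by
          rw [he]
          have := hs.1
          gcongr
          linarith
        have h7 : ‖x t - y t‖ ≤ ‖x s - y s‖ * e := h5.trans (by gcongr)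
        rw [← mul_pow]
        refine pow_le_pow_left₀ (by positivity) ?_ 2
        rw [one_div, inv_mul_le_iff₀ hepos]
        linarith
    rwa [intervalIntegral.integral_const, sub_zero, smul_eq_mul] at hle
  have hsymm : ∫ s in 0..t, ‖y s - x s‖ ^ 2 = ∫ s in 0..t, ‖x s - y s‖ ^ 2 :=
    intervalIntegral.integral_congr fun s _ => by simp only [norm_sub_rev]
  rw [hsymm] at h1
  have h8 := mul_le_mul_of_nonneg_left hint hc.le
  simp only [calibration, hkK] at h1 h2
  rw [← neg_sub (x t).1 (y t).1, ← neg_sub (x 0).1 (y 0).1] at h1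
  rw [← neg_sub (x 0).1 (y 0).1] at h3
  simp only [norm_neg, inner_neg_right] at h1 h3
  rw [inner_sub_right, real_inner_comm (x t).2, real_inner_comm (y t).2]
  linarith

/-- The graph transported by the flow over a short time projects onto the whole space. -/
theorem exists_characteristic {K : ℝ} (hK : 0 ≤ K) {u : Space d → ℝ} (hu : IsSemiConvex K u)
    {t : ℝ} (ht : 0 < t) (htK : M * t * (2 * (3 + 2 * K) ^ 2) ≤ 1) {c k : ℝ} (hc : 0 < c)
    (hk : 2 * k ≤ 1 + 2 * K)
    (hmono : ∀ x y : ℝ → Space d × Space d, IsOrbit H x → IsOrbit H y →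
      x 0 ∈ paraboloidGraph K u → y 0 ∈ paraboloidGraph K u →
      c * ‖x t - y t‖ ^ 2 ≤ ⟪(x t).1 - (y t).1, (x t).2 - (y t).2⟫_ℝ
        + 2 * k * ‖(x t).1 - (y t).1‖ ^ 2) (q : Space d) :
    ∃ x : ℝ → Space d × Space d, IsOrbit H x ∧ x 0 ∈ paraboloidGraph K u ∧ (x t).1 = q := by
  choose a ha haz using hu.exists_paraboloidGraph_resolvent
  choose x hx hx0 using fun z => hH.exists_orbit hM 0 (a z)
  have hxa : ∀ z, x z 0 ∈ paraboloidGraph K u := fun z => by rw [hx0]; exact ha z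
  -- The Minty coordinate at time `t` as a function of its value `z` at time `0`.
  let Z : Space d → Space d := fun z => (1 + 2 * K) • (x z t).1 + (x z t).2
  have hcomb : ∀ w : Space d × Space d, ‖(1 + 2 * K) • w.1 + w.2‖ ≤ (2 + 2 * K) * ‖w‖ := by
    intro w
    have h1 := norm_fst_le w
    have h2 := norm_snd_le w
    refine (norm_add_le _ _).trans ?_
    rw [norm_smul, Real.norm_of_nonneg (by positivity)]
    have := mul_le_mul_of_nonneg_left h1 (by positivity : 0 ≤ 1 + 2 * K)
    linarith
  have hZsub : ∀ z z', Z z - Z z' =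
      (1 + 2 * K) • (x z t - x z' t).1 + (x z t - x z' t).2 := fun z z' => by
    simp only [Z, Prod.fst_sub, Prod.snd_sub]
    module
  have hΛ : 3 / 2 * M * t * (3 + 2 * K) ^ 2 ≤ 3 / 4 := by linarith
  have hΛ' : 3 / 2 * M * t ≤ 1 / 12 := by
    have : 3 / 2 * M * t * 9 ≤ 3 / 2 * M * t * (3 + 2 * K) ^ 2 := by
      gcongr
      nlinarith
    linarith
  have hexp : Real.exp (3 / 2 * M * t) ≤ 12 / 11 := by
    refine (Real.exp_le_exp.2 hΛ').trans ?_
    refine (Real.exp_bound_div_one_sub_of_interval (by norm_num) (by norm_num)).trans ?_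
    norm_num
  have hZ : Function.Surjective Z := by
    refine surjective_of_sub_id_contracting (κ := 9 / 11) (by norm_num) fun z z' => ?_
    have e : (Z z - Z z') - (z - z') =
        (1 + 2 * K) • ((x z t - x z' t) - (x z 0 - x z' 0)).1
          + ((x z t - x z' t) - (x z 0 - x z' 0)).2 := by
      have h1 : z - z' = (1 + 2 * K) • (x z 0 - x z' 0).1 + (x z 0 - x z' 0).2 := by
        nth_rewrite 1 [← haz z, ← haz z']
        simp only [hx0, Prod.fst_sub, Prod.snd_sub]
        module
      rw [hZsub, h1]
      simp only [Prod.fst_sub, Prod.snd_sub]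
      module
    have h1 := hH.norm_orbit_sub_sub_le hM (hx z) (hx z') ht.le
    have h2 := norm_sub_le_of_mem_paraboloidGraph hK (ha z) (ha z')
    rw [haz, haz, ← hx0, ← hx0] at h2
    rw [sub_zero] at h1
    rw [e]
    calc _ ≤ (2 + 2 * K) * ‖(x z t - x z' t) - (x z 0 - x z' 0)‖ := hcomb _
      _ ≤ (2 + 2 * K) * (3 / 2 * M * t * (12 / 11) * ((1 + 2 * K) * ‖z - z'‖)) := by
        refine mul_le_mul_of_nonneg_left (h1.trans ?_) (by positivity)
        gcongr
      _ = 3 / 2 * M * t * ((2 + 2 * K) * (1 + 2 * K)) * (12 / 11) * ‖z - z'‖ := by ring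
      _ ≤ 3 / 2 * M * t * (3 + 2 * K) ^ 2 * (12 / 11) * ‖z - z'‖ := by
        gcongr
        nlinarith
      _ ≤ 3 / 4 * (12 / 11) * ‖z - z'‖ := by gcongr
      _ = 9 / 11 * ‖z - z'‖ := by ring
  obtain ⟨ζ, hζ⟩ := hZ.hasRightInverse
  -- Pairing the position difference with that of `w` produces the weight `1 + 2K` on the squared
  -- position difference; it dominates the `2k` of `hmono`.
  have key : ∀ w w', c * ‖x (ζ w) t - x (ζ w') t‖ ^ 2 ≤
      ⟪(x (ζ w) t).1 - (x (ζ w') t).1, w - w'⟫_ℝ := by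
    intro w w'
    have h1 := hmono _ _ (hx (ζ w)) (hx (ζ w')) (hxa _) (hxa _)
    have h2 := hZsub (ζ w) (ζ w')
    rw [hζ w, hζ w'] at h2
    rw [h2, inner_add_right, real_inner_smul_right, Prod.fst_sub, Prod.snd_sub,
      real_inner_self_eq_norm_sq]
    have := mul_le_mul_of_nonneg_right hk (sq_nonneg ‖(x (ζ w) t).1 - (x (ζ w') t).1‖)
    linarith
  have hsurj : Function.Surjective fun w => (x (ζ w) t).1 := by
    refine surjective_of_strongly_monotone (c := c / (2 + 2 * K) ^ 2) (L := 1 / c)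
      (by positivity) (fun w w' => ?_) fun w w' => ?_
    · refine le_trans ?_ (key w w')
      have h1 : ‖w - w'‖ ≤ (2 + 2 * K) * ‖x (ζ w) t - x (ζ w') t‖ := by
        have := hcomb (x (ζ w) t - x (ζ w') t)
        rwa [← hZsub, hζ w, hζ w'] at this
      rw [div_mul_eq_mul_div, div_le_iff₀ (by positivity), mul_assoc, ← mul_pow,
        mul_comm ‖_‖ (2 + 2 * K)]
      gcongr
    · have h1 := norm_fst_le (x (ζ w) t - x (ζ w') t)
      rw [Prod.fst_sub] at h1
      have h2 := le_div_of_mul_sq_le hc (norm_nonneg (x (ζ w) t - x (ζ w') t))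
        (norm_nonneg (w - w')) ((key w w').trans ((real_inner_le_norm _ _).trans (by gcongr)))
      refine h1.trans (h2.trans (le_of_eq ?_))
      ring
  obtain ⟨w, hw⟩ := hsurj q
  exact ⟨x (ζ w), hx _, hxa _, hw⟩

end IsUniformlyConvexHamiltonian

end Characteristics

end WeakKAM

/-! ### The main theorem -/

theorem mainTheorem9 (d : ℕ) (m M : ℝ)
    (H : ℝ × WeakKAM.Space d × WeakKAM.Space d → ℝ)
    (hH : WeakKAM.IsUniformlyConvexHamiltonian m M H)
    (K : ℝ) (hK : 0 ≤ K) (u : WeakKAM.Space d → ℝ) (hu : WeakKAM.IsSemiConvex K u)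
    (δ : ℝ) (hδ : δ ∈ Set.Ioo (0 : ℝ) 1)
    (t : ℝ) (ht : t ∈ Set.Ioc (0 : ℝ) (δ / (2 * M * (3 + 2 * K) ^ 2)))
    (n : ℕ) (hn : 1 ≤ n) (hnt : t / n < WeakKAM.twistTime m M) :
    -- the infimum that defines `T_0^t u` is finite
    (∀ q, BddBelow (Set.range fun θ => u θ + WeakKAM.minimalAction H n 0 t θ q)) ∧
    WeakKAM.IsSemiConvex (K + δ) (WeakKAM.laxOleinik H n 0 t u) ∧
    WeakKAM.IsC11 (WeakKAM.laxOleinik H n 0 t u) ∧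
    WeakKAM.subDifferentialGraph u =
      WeakKAM.flow H t 0 '' WeakKAM.differentialGraph (WeakKAM.laxOleinik H n 0 t u) ∧
    (∀ q, WeakKAM.laxOleinik H n 0 t u q =
      u (WeakKAM.flow H t 0 (q, gradient (WeakKAM.laxOleinik H n 0 t u) q)).1 +
      WeakKAM.minimalAction H n 0 t
        (WeakKAM.flow H t 0 (q, gradient (WeakKAM.laxOleinik H n 0 t u) q)).1 q) ∧
    -- the supremum that defines `Ť_t^0 (T_0^t u)` is finite
    (∀ q, BddAbove (Set.range fun θ =>
      WeakKAM.laxOleinik H n 0 t u θ - WeakKAM.minimalAction H n 0 t q θ)) ∧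
    WeakKAM.dualLaxOleinik H n t 0 (WeakKAM.laxOleinik H n 0 t u) = u := by

  obtain ⟨hδ0, hδ1⟩ := hδ
  obtain ⟨ht0, htT⟩ := ht
  have hM0 : 0 ≤ M := by
    have h1 := hH.lower_bound 0 0 0
    have h2 := hH.upper_bound 0 0 0
    simp only [norm_zero] at h1 h2
    linarith
  -- For `M = 0` the upper bound on `t` would be a division by zero, hence `0`, contradicting `0 <
  -- t`.
  have hM : 0 < M := by
    refine lt_of_le_of_ne hM0 fun h => ?_
    rw [← h] at htT
    simp only [mul_zero, zero_mul, div_zero] at htT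
    linarith
  have hm := hH.m_pos
  have htM : M * t * (2 * (3 + 2 * K) ^ 2) ≤ δ := by
    rw [le_div_iff₀ (by positivity)] at htT
    linarith
  -- the affine semi-convexity modulus
  set r : ℝ := δ / (2 * t) with hr
  set k : ℝ → ℝ := fun s => K + s * r with hkdef
  have hr0 : 0 < r := by positivity
  have hrt : t * r = δ / 2 := by rw [hr]; field_simp
  have hrM : M * (3 + 2 * K) ^ 2 ≤ r := by
    rw [hr, le_div_iff₀ (by positivity)]
    linarith
  have hk : ∀ s, HasDerivAt k r s := fun s => by
    exact (((hasDerivAt_id s).mul_const r).const_add K).congr_deriv (one_mul r)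
  have hkK : k 0 = K := by simp [hkdef]
  have hkt : k t = K + δ / 2 := by simp only [hkdef, hrt]
  have hk0 : ∀ s ∈ Set.Icc 0 t, 0 ≤ k s := fun s hs => by
    have := mul_nonneg hs.1 hr0.le
    simp only [hkdef]
    linarith
  have hkle : ∀ s ∈ Set.Icc 0 t, k s ≤ K + 1 / 2 := fun s hs => by
    have := mul_le_mul_of_nonneg_right hs.2 hr0.le
    simp only [hkdef]
    linarith
  -- Here `(3 + 2K)²` enters: it dominates `3/2 + 2k + 4k²` for `k ≤ K + 1/2`, and `r ≥ M (3 +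
  -- 2K)²`. The surplus `M` makes the gap strict.
  have hkM : ∀ s ∈ Set.Icc 0 t, M ≤ r - M / 2 - 2 * k s * M - 4 * k s ^ 2 * M := fun s hs => by
    have h1 := hk0 s hs
    have h2 := hkle s hs
    have h3 : k s ^ 2 ≤ (K + 1 / 2) ^ 2 := pow_le_pow_left₀ h1 h2 2
    have h4 : M * (1 + 1 / 2 + 2 * k s + 4 * k s ^ 2) ≤ M * (3 + 2 * K) ^ 2 := by
      gcongr
      nlinarith
    linarith
  have hkM0 : ∀ s ∈ Set.Icc 0 t, 0 ≤ r - M / 2 - 2 * k s * M - 4 * k s ^ 2 * M :=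
    fun s hs => hM.le.trans (hkM s hs)
  obtain ⟨c, hc, hmono⟩ := hH.exists_strong_monotonicity hM (K := K) (u := u) ht0 hk hkK hk0
    (c := min (m / 4) M) (lt_min (by positivity) hM) (min_le_left _ _)
    fun s hs => (min_le_right _ _).trans (hkM s hs)
  choose x hx hx0 hxt using hH.exists_characteristic hM hK hu ht0 (by linarith) hc
    (by rw [hkt]; linarith) hmono
  set A := WeakKAM.minimalAction H n 0 t with hA
  set W := WeakKAM.laxOleinik H n 0 t u with hW
  -- the comparison with a characteristic
  have hcomp : ∀ y : ℝ → WeakKAM.Space d × WeakKAM.Space d, WeakKAM.IsOrbit H y →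
      y 0 ∈ WeakKAM.paraboloidGraph K u → ∀ q₀ q₁,
      u (y 0).1 + WeakKAM.action H 0 t y + WeakKAM.calibration k y t q₁ ≤ u q₀ + A q₀ q₁ := by
    intro y hy hy0 q₀ q₁
    have h1 := hH.minimalAction_ge hM ht0 hn hnt hk hk0 hkM0 hy q₀ q₁
    have h2 := hy0 q₀
    have h3 : WeakKAM.calibration k y 0 q₀ =
        inner ℝ (y 0).2 (q₀ - (y 0).1) - K * ‖q₀ - (y 0).1‖ ^ 2 := by
      rw [WeakKAM.calibration, hkK]
    linarith
  have hbdd : ∀ q, BddBelow (Set.range fun θ => u θ + A θ q) := by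
    intro q
    refine ⟨u (x q 0).1 + WeakKAM.action H 0 t (x q) + WeakKAM.calibration k (x q) t q, ?_⟩
    rintro _ ⟨θ, rfl⟩
    exact hcomp (x q) (hx q) (hx0 q) θ q
  have hWge : ∀ y : ℝ → WeakKAM.Space d × WeakKAM.Space d, WeakKAM.IsOrbit H y →
      y 0 ∈ WeakKAM.paraboloidGraph K u → ∀ q,
      u (y 0).1 + WeakKAM.action H 0 t y + WeakKAM.calibration k y t q ≤ W q :=
    fun y hy hy0 q => le_ciInf fun θ => hcomp y hy hy0 θ q
  have hWle : ∀ θ q, W q ≤ u θ + A θ q := fun θ q => ciInf_le (hbdd q) θ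
  have hAorb : ∀ y : ℝ → WeakKAM.Space d × WeakKAM.Space d, WeakKAM.IsOrbit H y →
      A (y 0).1 (y t).1 = WeakKAM.action H 0 t y := fun y hy =>
    hH.minimalAction_orbit hM ht0 hn hnt hk hk0 hkM0 hy
  have hWorb : ∀ y : ℝ → WeakKAM.Space d × WeakKAM.Space d, WeakKAM.IsOrbit H y →
      y 0 ∈ WeakKAM.paraboloidGraph K u →
      W (y t).1 = u (y 0).1 + A (y 0).1 (y t).1 := fun y hy hy0 => by
    refine le_antisymm (hWle _ _) ?_
    have h := hWge y hy hy0 (y t).1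
    rwa [WeakKAM.calibration_self, add_zero, ← hAorb y hy] at h
  -- the differential of `W`
  have hlip : ∀ y z : ℝ → WeakKAM.Space d × WeakKAM.Space d, WeakKAM.IsOrbit H y →
      WeakKAM.IsOrbit H z → y 0 ∈ WeakKAM.paraboloidGraph K u →
      z 0 ∈ WeakKAM.paraboloidGraph K u →
      ‖y t - z t‖ ≤ (1 + 2 * k t) / c * ‖(y t).1 - (z t).1‖ := by
    intro y z hy hz hy0 hz0
    have hkt0 : 0 ≤ k t := hk0 t ⟨ht0.le, le_rfl⟩
    have h1 := hmono y z hy hz hy0 hz0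
    have h2 : ‖(y t).1 - (z t).1‖ ≤ ‖y t - z t‖ := norm_fst_le (y t - z t)
    have h3 : ‖(y t).2 - (z t).2‖ ≤ ‖y t - z t‖ := norm_snd_le (y t - z t)
    have h4 := (real_inner_le_norm ((y t).1 - (z t).1) ((y t).2 - (z t).2)).trans
      (mul_le_mul_of_nonneg_left h3 (norm_nonneg _))
    have h5 := mul_le_mul_of_nonneg_left (mul_le_mul_of_nonneg_right h2
      (norm_nonneg ((y t).1 - (z t).1))) hkt0
    have h6 := WeakKAM.le_div_of_mul_sq_le hc (norm_nonneg (y t - z t))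
      (b := (1 + 2 * k t) * ‖(y t).1 - (z t).1‖) (by positivity) (by linarith)
    rwa [mul_div_right_comm] at h6
  set g : WeakKAM.Space d → WeakKAM.Space d := fun q => (x q t).2 with hg
  have hxtg : ∀ q, x q t = (q, g q) := fun q => Prod.ext (hxt q) rfl
  have hsupp : ∀ q q', W q + inner ℝ (g q) (q' - q) - k t * ‖q' - q‖ ^ 2 ≤ W q' := by
    intro q q'
    have h1 := hWge (x q) (hx q) (hx0 q) q'
    have h2 := hWorb (x q) (hx q) (hx0 q)
    rw [hAorb (x q) (hx q), hxt] at h2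
    rw [WeakKAM.calibration, hxt] at h1
    rw [h2]
    linarith
  have hglip : ∀ q q', ‖g q - g q'‖ ≤ (1 + 2 * k t) / c * ‖q - q'‖ := by
    intro q q'
    have h := hlip (x q) (x q') (hx q) (hx q') (hx0 q) (hx0 q')
    rw [hxt, hxt] at h
    exact (norm_snd_le (x q t - x q' t)).trans h
  have hdW : ∀ q, HasFDerivAt W (innerSL ℝ (g q)) q :=
    WeakKAM.hasFDerivAt_of_quadratic_support hsupp hglip
  have hgrad : ∀ q, gradient W q = g q := fun q =>
    HasGradientAt.gradient (show HasGradientAt W (g q) q from hdW q)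
  have hback : ∀ y : ℝ → WeakKAM.Space d × WeakKAM.Space d, WeakKAM.IsOrbit H y →
      WeakKAM.flow H t 0 (y t) = y 0 := fun y hy => hH.flow_eq hM hy t 0
  -- Two characteristics with the same final position have the same final momentum, so the chosen
  -- family `x q` contains all of them; hence the equality of graphs rather than one inclusion.
  have hend : ∀ y : ℝ → WeakKAM.Space d × WeakKAM.Space d, WeakKAM.IsOrbit H y →
      y 0 ∈ WeakKAM.paraboloidGraph K u → y t = ((y t).1, g (y t).1) := by
    intro y hy hy0
    have h := hlip y (x (y t).1) hy (hx _) hy0 (hx0 _)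
    rw [hxt, sub_self, norm_zero, mul_zero] at h
    rw [← hxtg]
    exact sub_eq_zero.1 (norm_eq_zero.1 (le_antisymm h (norm_nonneg _)))
  have hdual : ∀ q θ, W θ - A q θ ≤ u q := fun q θ => by
    have := hWle q θ
    linarith
  have hbddA : ∀ q, BddAbove (Set.range fun θ => W θ - A q θ) := fun q => by
    refine ⟨u q, ?_⟩
    rintro _ ⟨θ, rfl⟩
    exact hdual q θ
  refine ⟨hbdd, ?_, ⟨fun q => (hdW q).differentiableAt,
    Real.toNNReal ((1 + 2 * k t) / c), LipschitzWith.of_dist_le_mul fun q q' => ?_⟩, ?_, ?_,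
    hbddA, ?_⟩
  · refine WeakKAM.convexOn_of_quadratic_support (g := g) fun q q' => (le_trans ?_ (hsupp q q'))
    have h1 : k t ≤ K + δ := by rw [hkt]; linarith
    have h2 := mul_le_mul_of_nonneg_right h1 (sq_nonneg ‖q' - q‖)
    linarith
  · rw [(hdW q).fderiv, (hdW q').fderiv, dist_eq_norm, dist_eq_norm, ← map_sub,
      innerSL_apply_norm]
    exact (hglip q q').trans (mul_le_mul_of_nonneg_right (Real.le_coe_toNNReal _)
      (norm_nonneg _))
  · rw [WeakKAM.subDifferentialGraph_eq hu]
    ext z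
    constructor
    · intro hz
      obtain ⟨y, hy, rfl⟩ := hH.exists_orbit hM 0 z
      refine ⟨y t, ⟨(hdW _).differentiableAt, ?_⟩, hback y hy⟩
      rw [hgrad]
      have h := congrArg Prod.snd (hend y hy hz)
      exact h
    · rintro ⟨⟨q, p⟩, ⟨-, hp⟩, rfl⟩
      simp only [hgrad] at hp
      rw [hp, ← hxtg, hback _ (hx q)]
      exact hx0 q
  · intro q
    rw [hgrad, ← hxtg, hback _ (hx q)]
    have h := hWorb (x q) (hx q) (hx0 q)
    rwa [hxt] at h
  · funext q
    refine le_antisymm (ciSup_le (hdual q)) ?_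
    -- A semi-convex function has a sub-differential at every point; the end position of the orbit
    -- from `(q, p)` attains the supremum.
    obtain ⟨p, hp⟩ := hu.exists_mem_paraboloidGraph q
    obtain ⟨y, hy, hy0⟩ := hH.exists_orbit hM 0 (q, p)
    have h := hWorb y hy (by rw [hy0]; exact hp)
    have h2 := le_ciSup (hbddA q) (y t).1
    rw [hy0] at h
    simp only [h, add_sub_cancel_right] at h2
    exact h2
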